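/- Consider $n\ge 1$ agents with independent private values $v_i\ge 0$, where $v_i$ is drawn from an arbitrary distribution $F_i$ on $[0,\infty)$ with finite mean, and an arbitrary nonempty family $\mathcal P\subseteq 2^{\{1,\dots,n\}}$ of feasible sets of agents. The optimal surplus is $\mathrm{OPT}^V=\mathbb E\big[\max_{S\in\mathcal P}\sum_{i\in S}v_i\big]$. The optimal consumer surplus $\mathrm{OPT}^U$ is the supremum, over all (randomized) direct mechanisms that always serve a set in $\mathcal P$ and are Bayesian incentive compatible on $[0,\infty)$, individually rational (agents never pay more than the value they obtain) and free of positive transfers (payments are nonnegative), of the expected total value of the served agents minus the expected total payments. The optimal omniscient approximation $\zeta(n)$ is the supremum of $\mathrm{OPT}^V/\mathrm{OPT}^U$ over all $n$-agent environments $(F_1,\dots,F_n,\mathcal P)$ (with $a/0=\infty$ for $a>0$, and the trivial ratio $0/0$ ignored). (a) For every $n\ge 1$ and every $\epsilon$ with $0<\epsilon<\frac1{2n}$, $$\zeta(n)\;\le\;B(n,\epsilon):=\frac{1-\ln\epsilon}{\big(1-\frac{\epsilon}{1-\epsilon}\big)(1-\epsilon)(1-2n\epsilon)}.$$ (b) For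 $\epsilon=\frac1{n\ln n}$ this bound satisfies $B\big(n,\tfrac{1}{n\ln n}\big)=(1+o(1))\ln n$ as $n\to\infty$. (c) Consequently $\zeta(n)\le(1+o(1))\ln n$: there is a sequence $\delta_n\to 0$ with $\zeta(n)\le(1+\delta_n)\ln n$ for all $n\ge 2$. -/

import Mathlib

open scoped NNReal ENNReal Topology

noncomputable section

/-- An `n`-agent (single-parameter, Bayesian) environment: agent `i` has a private value drawn
from the distribution `dist i` on `[0, ∞)` with finite mean, independently of the other agents,
and `feasible` is an arbitrary nonempty family of sets of agents that may be served together. -/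
structure Env (n : ℕ) where
  dist : Fin n → MeasureTheory.Measure ℝ≥0
  isProb : ∀ i, MeasureTheory.IsProbabilityMeasure (dist i)
  finiteMean : ∀ i, ∫⁻ x, (x : ℝ≥0∞) ∂(dist i) < ∞
  feasible : Finset (Finset (Fin n))
  feasible_nonempty : feasible.Nonempty

namespace Env

variable {n : ℕ} (E : Env n)

instance (i : Fin n) : MeasureTheory.IsProbabilityMeasure (E.dist i) := E.isProb i

/-- The joint (product) distribution of the value profile. -/
def prior : MeasureTheory.Measure (Fin n → ℝ≥0) := MeasureTheory.Measure.pi E.dist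

/-- The expected optimal surplus: the expectation of the largest total value of a feasible set. -/
def optSurplus : ℝ≥0∞ :=
  ∫⁻ v, E.feasible.sup (fun S => ∑ i ∈ S, (v i : ℝ≥0∞)) ∂E.prior

/-- A (randomized) direct mechanism. For each reported profile `v` it picks the set of served
agents from a probability distribution `lottery v` on the feasible sets, and charges agent `i`
the (expected, over the coins of the mechanism) payment `pay i v`. -/
structure Mechanism where
  lottery : (Fin n → ℝ≥0) → Finset (Fin n) → ℝ
  pay : Fin n → (Fin n → ℝ≥0) → ℝ
  lottery_nonneg : ∀ v S, 0 ≤ lottery v S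
  lottery_feasible : ∀ v S, S ∉ E.feasible → lottery v S = 0
  lottery_sum : ∀ v, ∑ S ∈ E.feasible, lottery v S = 1
  measurable_lottery : ∀ S, Measurable (fun v => lottery v S)
  measurable_pay : ∀ i, Measurable (pay i)

namespace Mechanism

variable {E} (M : E.Mechanism)

/-- The probability that agent `i` is served when the reported profile is `v`. -/
def winProb (i : Fin n) (v : Fin n → ℝ≥0) : ℝ :=
  ∑ S ∈ E.feasible with i ∈ S, M.lottery v S

/-- Interim allocation: the probability that agent `i` is served when it reports `r`, the values
of the other agents being drawn from the prior. -/
def interimAlloc (i : Fin n) (r : ℝ≥0) : ℝ :=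
  ∫ v, M.winProb i (Function.update v i r) ∂E.prior

/-- Interim payment: the expected payment of agent `i` when it reports `r`. -/
def interimPay (i : Fin n) (r : ℝ≥0) : ℝ :=
  ∫ v, M.pay i (Function.update v i r) ∂E.prior

/-- Bayesian incentive compatibility: an agent with value `x` does not gain in expectation
by reporting another value `r`. -/
def IsBIC : Prop :=
  ∀ (i : Fin n) (x r : ℝ≥0),
    (x : ℝ) * M.interimAlloc i r - M.interimPay i r
      ≤ (x : ℝ) * M.interimAlloc i x - M.interimPay i x

/-- No agent is paid by the mechanism. -/
def NoPositiveTransfers : Prop :=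
  ∀ (i : Fin n) (v : Fin n → ℝ≥0), 0 ≤ M.pay i v

/-- Individual rationality: an agent never pays more than the value it receives. -/
def IsIR : Prop :=
  ∀ (i : Fin n) (v : Fin n → ℝ≥0), M.pay i v ≤ (v i : ℝ) * M.winProb i v

/-- The expected consumer surplus: total value of the served agents minus total payments. -/
def consumerSurplus : ℝ :=
  ∫ v, ∑ i, ((v i : ℝ) * M.winProb i v - M.pay i v) ∂E.prior

end Mechanism

/-- The expected optimal consumer surplus: the supremum over all Bayesian incentive compatible,
individually rational mechanisms without positive transfers. -/
def optConsumerSurplus : ℝ≥0∞ :=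
  ⨆ (M : E.Mechanism) (_ : M.IsBIC ∧ M.NoPositiveTransfers ∧ M.IsIR),
    ENNReal.ofReal M.consumerSurplus

end Env

/-- The optimal omniscient approximation `ζ(n)`: the worst case, over all `n`-agent environments,
of the ratio of the optimal surplus to the optimal consumer surplus. In `ℝ≥0∞` a ratio `a / 0`
with `a > 0` is `∞`, while the degenerate ratio `0 / 0` counts as `0`; both optima are finite. -/
def zeta (n : ℕ) : ℝ≥0∞ :=
  ⨆ E : Env n, E.optSurplus / E.optConsumerSurplus

/-- The bound `(1 - ln ε) / ((1 - ε / (1 - ε)) (1 - ε) (1 - 2 n ε))`. -/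
def omniscientBound (n : ℕ) (ε : ℝ) : ℝ :=
  (1 - Real.log ε) / ((1 - ε / (1 - ε)) * (1 - ε) * (1 - 2 * (n : ℝ) * ε))

end

/-!
Why the surplus exceeds the consumer surplus by at most `(1 - ln ε) / (1 - n ε)`.

Give every value a quantile, uniform on `[0, 1]`, with small quantiles for high values and a coin
to split atoms (`quantile`, `measure_quantile_le`). Write `G` for the tail of a value. The average
value over the quantiles below `s` is `W(s) = ∫ min (G(z) / s) 1 dz` (`topMean`), and serving the
agent exactly when its quantile is at most `τ`, at the corresponding threshold price, leaves it the
utility `U(τ) = ∫ G(z) 1{G(z) ≤ τ} dz` (`excess`). Integrating `min (g / s) 1 = g + ∫_s^1 1{g ≤ τ}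
g / τ² dτ` over `z` gives `W(s) = W(1) + ∫_s^1 U(τ) / τ² dτ` (`topMean_le`).

Let `a` be the rule that selects the feasible set of largest total score, the score of a type of
quantile `q` being `W(max q ε)`. For `ε < τ < 1` consider the mechanism that records for each agent
only whether its quantile is at most `τ`, redraws a type for it conditionally on this bit, and runs
`a` on the redrawn types. Redrawing reproduces the law of the types (`interimAlloc_resampled`), so
an agent is served with one of two probabilities, the larger one if its quantile is at most `τ`;
suitable payments make this incentive compatible and leave the agent at least the larger
probability times `U(τ)` (`sum_lintegral_utility_le_optConsumerSurplus`,
`sum_selectProb_mul_excess_le`). Running `a` on fresh types without payments yields the selection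
probabilities times the means (`sum_selectProb_mul_mean_le`). Adding the last utility, with weight
`1`, and the former, with weight `dτ / τ` on `(ε, 1)`, of total weight `1 - ln ε`, the formula for
`W` turns the sum into at least the expected largest total score: it is therefore at most
`(1 - ln ε) OPT^U` (`lintegral_maxTotal_score_le`).

Finally the score of a type is at least its value for quantiles above `ε`, and on average for
quantiles below `ε`. Since all agents but one have quantiles above `ε` with probability at least
`1 - n ε`, replacing values by scores costs at most this factor of the optimum
(`one_sub_mul_lintegral_maxTotal_le`). As `(1 - 2 ε) (1 - 2 n ε) ≤ 1 - n ε`, the bound follows.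
-/

set_option linter.unusedSectionVars false

open MeasureTheory

/-! ### Integration over product measures -/

section ProductMeasure

variable {ι : Type*} [Fintype ι] {α : ι → Type*} [∀ i, MeasurableSpace (α i)]
  (μ : ∀ i, Measure (α i)) [∀ i, IsProbabilityMeasure (μ i)]

/-- Redrawing the `i`-th coordinate of a random point leaves its product law unchanged. -/
lemma measurePreserving_update [DecidableEq ι] (i : ι) :
    MeasurePreserving (fun p : α i × (∀ j, α j) => Function.update p.2 i p.1)
      ((μ i).prod (Measure.pi μ)) (Measure.pi μ) := by
  have hm : Measurable (fun p : α i × (∀ j, α j) => Function.update p.2 i p.1) :=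
    measurable_update'.comp measurable_swap
  refine ⟨hm, ?_⟩
  symm
  refine Measure.pi_eq fun s hs => ?_
  rw [Measure.map_apply hm (MeasurableSet.univ_pi hs)]
  have : (fun p : α i × (∀ j, α j) => Function.update p.2 i p.1) ⁻¹' (Set.univ.pi s)
      = s i ×ˢ Set.univ.pi (Function.update s i Set.univ) := by
    ext ⟨a, x⟩
    simp only [Set.mem_preimage, Set.mem_pi, Set.mem_univ, true_implies, Set.mem_prod]
    constructor
    · intro h
      refine ⟨by simpa using h i, fun j => ?_⟩
      by_cases hj : j = i
      · subst hj; simp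
      · simpa [hj] using h j
    · rintro ⟨h1, h2⟩ j
      by_cases hj : j = i
      · subst hj; simpa using h1
      · simpa [hj] using h2 j
  rw [this, Measure.prod_prod, Measure.pi_pi, ← Finset.mul_prod_erase _ _ (Finset.mem_univ i),
    ← Finset.mul_prod_erase (s := Finset.univ) (f := fun j => μ j (s j)) (a := i)
      (Finset.mem_univ i)]
  simp only [Function.update_self, measure_univ, one_mul]
  congr 1
  refine Finset.prod_congr rfl fun j hj => ?_
  rw [Function.update_of_ne (Finset.ne_of_mem_erase hj)]

lemma lintegral_pi_update [DecidableEq ι] (i : ι) {g : (∀ j, α j) → ℝ≥0∞} (hg : Measurable g) :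
    ∫⁻ x, g x ∂Measure.pi μ
      = ∫⁻ s, ∫⁻ x, g (Function.update x i s) ∂Measure.pi μ ∂μ i := by
  have h := measurePreserving_update μ i
  rw [← h.lintegral_comp hg]
  exact lintegral_prod _ (hg.comp h.measurable).aemeasurable

lemma lintegral_pi_prod {f : ∀ i, α i → ℝ≥0∞} (hf : ∀ i, Measurable (f i)) :
    ∫⁻ x, ∏ i, f i (x i) ∂Measure.pi μ = ∏ i, ∫⁻ s, f i s ∂μ i := by
  have hind := ProbabilityTheory.iIndepFun_pi (μ := μ) (X := f) fun i => (hf i).aemeasurable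
  have := ProbabilityTheory.lintegral_prod_eq_prod_lintegral_of_indepFun Finset.univ
    (fun i (x : ∀ j, α j) => f i (x i)) hind fun i => (hf i).comp (measurable_pi_apply i)
  rw [this]
  refine Finset.prod_congr rfl fun i _ => ?_
  exact (measurePreserving_eval μ i).lintegral_comp (hf i)

lemma lintegral_pi_eval (i : ι) {f : α i → ℝ≥0∞} (hf : Measurable f) :
    ∫⁻ x, f (x i) ∂Measure.pi μ = ∫⁻ s, f s ∂μ i :=
  (measurePreserving_eval μ i).lintegral_comp hf

/-- If moving the `i`-th coordinate into `A` can only decrease `g`, then the integral of `g` over the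
event that this coordinate lies in `A` is at most the probability of `A` times the integral
of `g`. -/
lemma lintegral_indicator_eval_mul_le [DecidableEq ι] (i : ι) {A : Set (α i)} (hA : MeasurableSet A)
    {g : (∀ j, α j) → ℝ≥0∞} (hg : Measurable g)
    (hle : ∀ x, ∀ s ∈ A, g (Function.update x i s) ≤ g x) :
    ∫⁻ x, A.indicator 1 (x i) * g x ∂Measure.pi μ ≤ μ i A * ∫⁻ x, g x ∂Measure.pi μ := by
  have hm : Measurable fun x : ∀ j, α j => A.indicator (1 : α i → ℝ≥0∞) (x i) * g x :=
    ((measurable_one.indicator hA).comp (measurable_pi_apply i)).mul hg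
  rw [lintegral_pi_update μ i hm]
  calc _ ≤ ∫⁻ s, A.indicator (1 : α i → ℝ≥0∞) s * ∫⁻ x, g x ∂Measure.pi μ ∂μ i := by
        refine lintegral_mono fun s => ?_
        rw [← lintegral_const_mul _ hg]
        refine lintegral_mono fun x => ?_
        by_cases hs : s ∈ A
        · simpa [hs] using hle x s hs
        · simp [hs]
    _ = _ := by
        rw [lintegral_mul_const _ (measurable_one.indicator hA), lintegral_indicator_one hA]

end ProductMeasure

/-! ### Payments that implement an allocation rule -/

namespace Env

variable {n : ℕ} {E : Env n}

instance : IsProbabilityMeasure E.prior := by unfold prior; infer_instance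

namespace Mechanism

variable (M : E.Mechanism)

lemma winProb_nonneg (i : Fin n) (v : Fin n → ℝ≥0) : 0 ≤ M.winProb i v :=
  Finset.sum_nonneg fun S _ => M.lottery_nonneg v S

lemma winProb_le_one (i : Fin n) (v : Fin n → ℝ≥0) : M.winProb i v ≤ 1 := by
  rw [← M.lottery_sum v]
  exact Finset.sum_le_sum_of_subset_of_nonneg (Finset.filter_subset _ _)
    fun S _ _ => M.lottery_nonneg v S

lemma measurable_winProb (i : Fin n) : Measurable (M.winProb i) :=
  Finset.measurable_sum _ fun S _ => M.measurable_lottery S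

lemma measurable_winProb_update (i : Fin n) (r : ℝ≥0) :
    Measurable fun v => M.winProb i (Function.update v i r) :=
  (M.measurable_winProb i).comp measurable_update_left

lemma ofReal_interimAlloc (i : Fin n) (r : ℝ≥0) :
    ENNReal.ofReal (M.interimAlloc i r)
      = ∫⁻ v, ENNReal.ofReal (M.winProb i (Function.update v i r)) ∂E.prior := by
  refine ofReal_integral_eq_lintegral_ofReal ?_ (.of_forall fun v => M.winProb_nonneg _ _)
  refine Integrable.of_bound (M.measurable_winProb_update i r).aestronglyMeasurable 1
    (.of_forall fun v => ?_)
  rw [Real.norm_of_nonneg (M.winProb_nonneg _ _)]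
  exact M.winProb_le_one _ _

lemma interimAlloc_nonneg (i : Fin n) (r : ℝ≥0) : 0 ≤ M.interimAlloc i r :=
  integral_nonneg fun _ => M.winProb_nonneg _ _

/-- Charging a served agent its value minus its conditional expected utility implements the
interim allocation of `M`, provided `u i` is convex with subgradient the interim allocation: this
is the payment identity, with `u i r` the interim utility of type `r`. The payments are spread over
the profiles in proportion to the service probability, which makes them individually rational for
every profile and not only on average. -/
theorem sum_lintegral_utility_le_optConsumerSurplus (u : Fin n → ℝ≥0 → ℝ) (hu0 : ∀ i, u i 0 = 0)
    (humeas : ∀ i, Measurable (u i)) (hXmeas : ∀ i, Measurable (M.interimAlloc i))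
    (hsub : ∀ (i : Fin n) (x r : ℝ≥0),
      ((x : ℝ) - r) * M.interimAlloc i r ≤ u i x - u i r) :
    ∑ i, ∫⁻ r, ENNReal.ofReal (u i r) ∂E.dist i ≤ E.optConsumerSurplus := by
  have hu_nonneg (i) (r : ℝ≥0) : 0 ≤ u i r := by
    have h := hsub i r 0
    rw [hu0] at h
    have := mul_nonneg r.coe_nonneg (M.interimAlloc_nonneg i 0)
    simp only [NNReal.coe_zero, sub_zero] at h
    linarith
  have hu_le (i) (r : ℝ≥0) : u i r ≤ r * M.interimAlloc i r := by
    have h := hsub i 0 r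
    rw [hu0] at h
    simp only [NNReal.coe_zero, zero_sub] at h
    linarith
  -- the utility of a type, conditional on being served; `0` for a type that is never served
  set c : Fin n → ℝ≥0 → ℝ := fun i r => u i r / M.interimAlloc i r with hc
  have hc_nonneg (i) (r : ℝ≥0) : 0 ≤ c i r := div_nonneg (hu_nonneg i r) (M.interimAlloc_nonneg i r)
  have hc_le (i) (r : ℝ≥0) : c i r ≤ r :=
    div_le_of_le_mul₀ (M.interimAlloc_nonneg i r) r.coe_nonneg (hu_le i r)
  have hc_mul (i) (r : ℝ≥0) : c i r * M.interimAlloc i r = u i r := by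
    by_cases h : M.interimAlloc i r = 0
    · have := hu_le i r
      rw [h, mul_zero] at this ⊢
      exact le_antisymm (hu_nonneg i r) this
    · exact div_mul_cancel₀ _ h
  have hc_meas (i) : Measurable (c i) := (humeas i).div (hXmeas i)
  let M' : E.Mechanism :=
    { M with
      pay := fun i v => M.winProb i v * ((v i : ℝ) - c i (v i))
      measurable_pay := fun i => (M.measurable_winProb i).mul
        ((measurable_pi_apply i).coe_nnreal_real.sub ((hc_meas i).comp (measurable_pi_apply i))) }
  have halloc (i) (r : ℝ≥0) : M'.interimAlloc i r = M.interimAlloc i r := rfl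
  have hwin (i) (v) : M'.winProb i v = M.winProb i v := rfl
  have hpay (i) (v) : M'.pay i v = M.winProb i v * ((v i : ℝ) - c i (v i)) := rfl
  have hinterim (i) (r : ℝ≥0) : M'.interimPay i r = r * M.interimAlloc i r - u i r := by
    simp only [interimPay, hpay, Function.update_self]
    rw [integral_mul_const, ← hc_mul]
    simp only [interimAlloc]
    ring
  have hM' : M'.IsBIC ∧ M'.NoPositiveTransfers ∧ M'.IsIR := by
    refine ⟨fun i x r => ?_, fun i v => ?_, fun i v => ?_⟩
    · rw [hinterim, hinterim, halloc, halloc]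
      linarith [hsub i x r]
    · exact mul_nonneg (M.winProb_nonneg i v) (sub_nonneg.2 (hc_le i _))
    · rw [hpay, hwin]
      nlinarith [mul_nonneg (M.winProb_nonneg i v) (hc_nonneg i (v i))]
  refine le_trans ?_ (le_iSup₂_of_le M' hM' le_rfl)
  have hterm_meas (i) : Measurable fun v : Fin n → ℝ≥0 => M.winProb i v * c i (v i) :=
    (M.measurable_winProb i).mul ((hc_meas i).comp (measurable_pi_apply i))
  have hterm_nonneg (i) (v : Fin n → ℝ≥0) : 0 ≤ M.winProb i v * c i (v i) :=
    mul_nonneg (M.winProb_nonneg i v) (hc_nonneg i _)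
  have hint (i) : Integrable (fun v : Fin n → ℝ≥0 => M.winProb i v * c i (v i)) E.prior := by
    have hv : Integrable (fun v : Fin n → ℝ≥0 => (v i : ℝ)) E.prior := by
      refine ⟨(measurable_pi_apply i).coe_nnreal_real.aestronglyMeasurable, ?_⟩
      rw [hasFiniteIntegral_iff_ofReal (.of_forall fun v => (v i).coe_nonneg)]
      simp only [ENNReal.ofReal_coe_nnreal]
      exact (lintegral_pi_eval E.dist i measurable_coe_nnreal_ennreal).trans_lt (E.finiteMean i)
    refine hv.mono' (hterm_meas i).aestronglyMeasurable (.of_forall fun v => ?_)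
    rw [Real.norm_of_nonneg (hterm_nonneg i v)]
    calc _ ≤ 1 * c i (v i) := mul_le_mul_of_nonneg_right (M.winProb_le_one i v) (hc_nonneg i _)
      _ ≤ _ := by rw [one_mul]; exact hc_le i _
  have hCS : M'.consumerSurplus = ∫ v, ∑ i, M.winProb i v * c i (v i) ∂E.prior := by
    refine integral_congr_ae (.of_forall fun v => Finset.sum_congr rfl fun i _ => ?_)
    rw [hwin, hpay]
    ring
  rw [hCS, ofReal_integral_eq_lintegral_ofReal (integrable_finsetSum _ fun i _ => hint i)
    (.of_forall fun v => Finset.sum_nonneg fun i _ => hterm_nonneg i v)]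
  simp_rw [ENNReal.ofReal_sum_of_nonneg fun i _ => hterm_nonneg i _]
  rw [lintegral_finsetSum _ fun i _ => (hterm_meas i).ennreal_ofReal]
  refine le_of_eq (Finset.sum_congr rfl fun i _ => ?_)
  have := lintegral_pi_update E.dist i (hterm_meas i).ennreal_ofReal
  rw [prior, this]
  refine lintegral_congr fun r => ?_
  simp_rw [Function.update_self, mul_comm _ (c i r), ENNReal.ofReal_mul (hc_nonneg i r)]
  rw [lintegral_const_mul _ (M.measurable_winProb_update i r).ennreal_ofReal]
  have := M.ofReal_interimAlloc i r
  rw [prior] at this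
  rw [← this, ← ENNReal.ofReal_mul (hc_nonneg i r), hc_mul]

end Mechanism

end Env

/-! ### Running a selection rule on resampled types -/

/-- A randomized map from values to types: `density v` is the density, with respect to `μ`, of the
type drawn for an agent with value `v`. The field `lintegral_value` says that the type of an agent
whose value has law `F` has law exactly `μ`. -/
structure Resampling {X : Type*} [MeasurableSpace X] (F : Measure ℝ≥0) (μ : Measure X) where
  density : ℝ≥0 → X → ℝ≥0∞
  measurable_density : Measurable (Function.uncurry density)
  lintegral_type : ∀ v, ∫⁻ x, density v x ∂μ = 1
  lintegral_value : ∀ x, ∫⁻ v, density v x ∂F = 1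

namespace Env

/-- A measurable choice of a feasible set for every profile of types. -/
structure SelectionRule {n : ℕ} (E : Env n) (X : Type*) [MeasurableSpace X] where
  select : (Fin n → X) → Finset (Fin n)
  select_mem : ∀ x, select x ∈ E.feasible
  measurableSet_select : ∀ S, MeasurableSet (select ⁻¹' {S})

variable {n : ℕ} {E : Env n} {X : Type*} [MeasurableSpace X] {μ : Fin n → Measure X}
  [∀ i, IsProbabilityMeasure (μ i)]

namespace SelectionRule

variable (a : E.SelectionRule X)

lemma measurableSet_mem_finset (T : Finset (Finset (Fin n))) :
    MeasurableSet {x | a.select x ∈ T} := by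
  have : {x | a.select x ∈ T} = ⋃ S ∈ T, a.select ⁻¹' {S} := by ext x; simp
  rw [this]
  exact T.measurableSet_biUnion fun S _ => a.measurableSet_select S

lemma measurableSet_mem (i : Fin n) : MeasurableSet {x | i ∈ a.select x} := by
  have : {x | i ∈ a.select x} = {x | a.select x ∈ Finset.univ.filter (i ∈ ·)} := by ext x; simp
  rw [this]
  exact a.measurableSet_mem_finset _

variable (μ) in
/-- The probability that the rule selects agent `i` when its type is `s` and the types of the other
agents are random. -/
noncomputable def selectProb (i : Fin n) (s : X) : ℝ≥0∞ :=
  Measure.pi μ {x | i ∈ a.select (Function.update x i s)}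

lemma selectProb_le_one (i : Fin n) (s : X) : a.selectProb μ i s ≤ 1 := prob_le_one

lemma measurableSet_mem_update (i : Fin n) (s : X) :
    MeasurableSet {x | i ∈ a.select (Function.update x i s)} :=
  measurable_update_left (a.measurableSet_mem i)

lemma measurable_selectProb (i : Fin n) : Measurable (a.selectProb μ i) := by
  have h : MeasurableSet {p : X × (Fin n → X) | i ∈ a.select (Function.update p.2 i p.1)} :=
    (measurePreserving_update μ i).measurable (a.measurableSet_mem i)
  exact measurable_measure_prodMk_left h

lemma lintegral_select_eq (i : Fin n) {g : X → ℝ≥0∞} (hg : Measurable g) :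
    ∫⁻ x in {x | i ∈ a.select x}, g (x i) ∂Measure.pi μ
      = ∫⁻ s, g s * a.selectProb μ i s ∂μ i := by
  have hg' : Measurable fun x : Fin n → X => g (x i) := hg.comp (measurable_pi_apply i)
  rw [← lintegral_indicator (a.measurableSet_mem i),
    lintegral_pi_update μ i (hg'.indicator (a.measurableSet_mem i))]
  refine lintegral_congr fun s => ?_
  have : (fun x : Fin n → X => ({x | i ∈ a.select x}.indicator fun x => g (x i))
      (Function.update x i s))
      = {x | i ∈ a.select (Function.update x i s)}.indicator fun _ => g s := by
    ext x
    simp [Set.indicator_apply]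
  rw [this, lintegral_indicator_const (a.measurableSet_mem_update i s), selectProb]

variable (k : ∀ i, Resampling (E.dist i) (μ i))

lemma measurable_prod_density :
    Measurable fun p : (Fin n → ℝ≥0) × (Fin n → X) => ∏ j, (k j).density (p.1 j) (p.2 j) :=
  Finset.measurable_fun_prod _ fun j _ => by
    have h : Measurable fun p : (Fin n → ℝ≥0) × (Fin n → X) => (p.1 j, p.2 j) := by fun_prop
    exact (k j).measurable_density.comp h

lemma measurable_density_right {F : Measure ℝ≥0} {ν : Measure X} (κ : Resampling F ν) (v : ℝ≥0) :
    Measurable (κ.density v) := κ.measurable_density.comp measurable_prodMk_left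

lemma measurable_density_left {F : Measure ℝ≥0} {ν : Measure X} (κ : Resampling F ν) (x : X) :
    Measurable fun v => κ.density v x := κ.measurable_density.comp measurable_prodMk_right

lemma lintegral_prod_density (v : Fin n → ℝ≥0) :
    ∫⁻ x, ∏ j, (k j).density (v j) (x j) ∂Measure.pi μ = 1 := by
  rw [lintegral_pi_prod μ fun j => measurable_density_right (k j) (v j)]
  simp [(k _).lintegral_type]

lemma setLIntegral_prod_density_ne_top (v : Fin n → ℝ≥0) (A : Set (Fin n → X)) :
    ∫⁻ x in A, ∏ j, (k j).density (v j) (x j) ∂Measure.pi μ ≠ ∞ :=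
  ((setLIntegral_le_lintegral _ _).trans_lt
    (by rw [lintegral_prod_density k v]; exact ENNReal.one_lt_top)).ne

lemma sum_toReal_setLIntegral (v : Fin n → ℝ≥0) (T : Finset (Finset (Fin n))) :
    ∑ S ∈ T, (∫⁻ x in a.select ⁻¹' {S}, ∏ j, (k j).density (v j) (x j) ∂Measure.pi μ).toReal
      = (∫⁻ x in {x | a.select x ∈ T}, ∏ j, (k j).density (v j) (x j) ∂Measure.pi μ).toReal := by
  have : {x | a.select x ∈ T} = ⋃ S ∈ T, a.select ⁻¹' {S} := by ext x; simp
  rw [this, lintegral_biUnion_finset _ fun S _ => a.measurableSet_select S,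
    ENNReal.toReal_sum fun S _ => setLIntegral_prod_density_ne_top k v _]
  intro S _ T _ hST
  exact Set.disjoint_left.2 fun x hx hx' => hST (hx.symm.trans hx')

/-- The mechanism, without payments, that draws a type for each agent from its reported value and
serves the set selected for these types. -/
noncomputable def resampled : E.Mechanism where
  lottery v S :=
    (∫⁻ x in a.select ⁻¹' {S}, ∏ j, (k j).density (v j) (x j) ∂Measure.pi μ).toReal
  pay _ _ := 0
  lottery_nonneg _ _ := ENNReal.toReal_nonneg
  lottery_feasible v S hS := by
    have : a.select ⁻¹' {S} = ∅ := by
      refine Set.eq_empty_of_forall_notMem fun x hx => hS ?_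
      rw [← show a.select x = S from hx]
      exact a.select_mem x
    simp [this]
  lottery_sum v := by
    rw [a.sum_toReal_setLIntegral k v]
    simp [a.select_mem, lintegral_prod_density k v]
  measurable_lottery S := (Measurable.lintegral_prod_right
    (ν := (Measure.pi μ).restrict (a.select ⁻¹' {S})) (measurable_prod_density k)).ennreal_toReal
  measurable_pay _ := measurable_const

lemma winProb_resampled (i : Fin n) (v : Fin n → ℝ≥0) :
    (a.resampled k).winProb i v
      = (∫⁻ x in {x | i ∈ a.select x}, ∏ j, (k j).density (v j) (x j) ∂Measure.pi μ).toReal := by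
  have h : {x | i ∈ a.select x} = {x | a.select x ∈ E.feasible.filter (i ∈ ·)} := by
    ext x; simp [a.select_mem]
  rw [h, ← a.sum_toReal_setLIntegral k v]
  rfl

/-- Since resampling reproduces the law of the types of the other agents, an agent reporting `r`
is served as if it drew a type from `r` and met fresh random types. -/
lemma interimAlloc_resampled (i : Fin n) (r : ℝ≥0) :
    (a.resampled k).interimAlloc i r
      = (∫⁻ s, (k i).density r s * a.selectProb μ i s ∂μ i).toReal := by
  have hswap : ∫⁻ v, ∫⁻ x in {x | i ∈ a.select x},
        ∏ j, (k j).density (Function.update v i r j) (x j) ∂Measure.pi μ ∂E.prior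
      = ∫⁻ x in {x | i ∈ a.select x}, (k i).density r (x i) ∂Measure.pi μ := by
    rw [lintegral_lintegral_swap]
    · refine lintegral_congr fun x => ?_
      have h1 : ∀ v : Fin n → ℝ≥0, ∏ j, (k j).density (Function.update v i r j) (x j)
          = ∏ j, (if j = i then fun _ => (k i).density r (x i)
              else fun w => (k j).density w (x j)) (v j) := by
        refine fun v => Finset.prod_congr rfl fun j _ => ?_
        by_cases hj : j = i
        · subst hj; simp
        · simp [hj]
      simp_rw [h1]
      rw [prior, lintegral_pi_prod E.dist
        (f := fun j => if j = i then fun _ => (k i).density r (x i)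
              else fun w => (k j).density w (x j))]
      · rw [Finset.prod_eq_single i]
        · simp
        · intro j _ hj
          simp [hj, (k j).lintegral_value]
        · simp
      · intro j
        by_cases hj : j = i
        · simp only [hj, if_true]; exact measurable_const
        · simp only [hj, if_false]; exact measurable_density_left (k j) (x j)
    · refine Measurable.aemeasurable ?_
      exact (measurable_prod_density k).comp
        ((measurable_update_left.comp measurable_fst).prodMk measurable_snd)
  rw [← a.lintegral_select_eq i (measurable_density_right (k i) r), ← hswap]
  simp only [Mechanism.interimAlloc, winProb_resampled]
  refine integral_toReal ?_ (.of_forall fun v => ?_)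
  · refine Measurable.aemeasurable ?_
    exact Measurable.lintegral_prod_right (ν := (Measure.pi μ).restrict {x | i ∈ a.select x})
      ((measurable_prod_density k).comp
        ((measurable_update_left.comp measurable_fst).prodMk measurable_snd))
  · exact (setLIntegral_prod_density_ne_top k _ _).lt_top

end SelectionRule

end Env

/-! ### Tails, thresholds and quantiles -/

section Quantile

variable (F : Measure ℝ≥0) [IsProbabilityMeasure F]

/-- The probability that the value exceeds `z`. -/
noncomputable def tail (z : ℝ) : ℝ := F.real {w : ℝ≥0 | z < w}

lemma measurableSet_lt_coe (z : ℝ) : MeasurableSet {w : ℝ≥0 | z < w} :=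
  measurableSet_lt measurable_const measurable_coe_nnreal_real

lemma tail_nonneg (z : ℝ) : 0 ≤ tail F z := measureReal_nonneg

lemma tail_le_one (z : ℝ) : tail F z ≤ 1 := measureReal_le_one

lemma tail_antitone : Antitone (tail F) := fun _ _ h =>
  measureReal_mono fun _ hw => h.trans_lt hw

lemma measurable_tail : Measurable (tail F) := (tail_antitone F).measurable

lemma ofReal_tail (z : ℝ) : ENNReal.ofReal (tail F z) = F {w : ℝ≥0 | z < w} :=
  ofReal_measureReal

/-- The quantile of the value `x.1`, ties being broken by the coin `x.2`: the probability that
a fresh value is larger, plus a uniform share of the probability of a tie. Small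
quantiles belong to high values. -/
noncomputable def quantile (x : ℝ≥0 × unitInterval) : ℝ :=
  tail F x.1 + x.2 * F.real {x.1}

lemma tail_add_singleton (w : ℝ≥0) : tail F w + F.real {w} = F.real (Set.Ici w) := by
  rw [tail, add_comm, ← measureReal_union _ (measurableSet_lt_coe _)]
  · congr 1
    ext x
    simp [le_iff_eq_or_lt, eq_comm]
  · simp

lemma measurable_quantile : Measurable (quantile F) := by
  have h1 : Measurable fun w : ℝ≥0 => tail F w :=
    (measurable_tail F).comp measurable_coe_nnreal_real
  have h2 : Measurable fun w : ℝ≥0 => F.real {w} := by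
    have h3 : Measurable fun w : ℝ≥0 => F.real (Set.Ici w) :=
      Antitone.measurable fun _ _ h => measureReal_mono (Set.Ici_subset_Ici.2 h)
    have : (fun w : ℝ≥0 => F.real {w}) = fun w => F.real (Set.Ici w) - tail F w := by
      ext w; rw [← tail_add_singleton]; ring
    rw [this]
    exact h3.sub h1
  exact (h1.comp measurable_fst).add
    ((measurable_subtype_coe.comp measurable_snd).mul (h2.comp measurable_fst))

lemma tail_le_quantile (x : ℝ≥0 × unitInterval) : tail F x.1 ≤ quantile F x :=
  le_add_of_nonneg_right (mul_nonneg x.2.2.1 measureReal_nonneg)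

lemma quantile_le (x : ℝ≥0 × unitInterval) : quantile F x ≤ F.real (Set.Ici x.1) := by
  rw [← tail_add_singleton]
  exact add_le_add_right (mul_le_of_le_one_left measureReal_nonneg x.2.2.2) _

lemma quantile_le_tail_of_lt {x : ℝ≥0 × unitInterval} {z : ℝ} (h : z < x.1) :
    quantile F x ≤ tail F z :=
  (quantile_le F x).trans (measureReal_mono fun _ hw => h.trans_le (NNReal.coe_le_coe.2 hw))

lemma quantile_le_one (x : ℝ≥0 × unitInterval) : quantile F x ≤ 1 :=
  (quantile_le F x).trans measureReal_le_one

/-- The value at quantile `τ`: for `τ > 0`, the smallest value that is exceeded with probability at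
most `τ`. -/
noncomputable def threshold (τ : ℝ) : ℝ≥0 := sInf {z : ℝ≥0 | tail F z ≤ τ}

lemma tail_threshold_le {τ : ℝ} (hτ : 0 < τ) : tail F (threshold F τ) ≤ τ := by
  have hne : {z : ℝ≥0 | tail F z ≤ τ}.Nonempty := by
    have h : Filter.Tendsto (fun m : ℕ => F.real {w : ℝ≥0 | ((m : ℝ≥0) : ℝ) < w}) Filter.atTop
        (𝓝 (F.real (⋂ m : ℕ, {w : ℝ≥0 | ((m : ℝ≥0) : ℝ) < w}))) := by
      refine (ENNReal.tendsto_toReal (measure_ne_top _ _)).comp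
        (tendsto_measure_iInter_atTop (fun m => (measurableSet_lt_coe _).nullMeasurableSet)
          (fun a b hab w hw => ?_) ⟨0, measure_ne_top _ _⟩)
      exact lt_of_le_of_lt (by exact_mod_cast hab) (show ((b : ℝ≥0) : ℝ) < w from hw)
    have he : ⋂ m : ℕ, {w : ℝ≥0 | ((m : ℝ≥0) : ℝ) < w} = ∅ := by
      refine Set.eq_empty_of_forall_notMem fun w hw => ?_
      obtain ⟨m, hm⟩ := exists_nat_ge (w : ℝ)
      have := Set.mem_iInter.1 hw m
      simp only [Set.mem_ofPred_eq, NNReal.coe_natCast] at this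
      linarith
    rw [he, measureReal_empty] at h
    obtain ⟨m, hm⟩ := (h.eventually (ge_mem_nhds hτ)).exists
    exact ⟨m, hm⟩
  obtain ⟨u, hu, hlim, hmem⟩ := exists_seq_tendsto_sInf hne ⟨0, fun _ _ => zero_le⟩
  have h : Filter.Tendsto (fun m : ℕ => F.real {w : ℝ≥0 | (u m : ℝ) < w}) Filter.atTop
      (𝓝 (F.real (⋃ m : ℕ, {w : ℝ≥0 | (u m : ℝ) < w}))) := by
    refine (ENNReal.tendsto_toReal (measure_ne_top _ _)).comp
      (tendsto_measure_iUnion_atTop fun a b hab w hw => ?_)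
    exact lt_of_le_of_lt (NNReal.coe_le_coe.2 (hu hab)) hw
  have hsub : {w : ℝ≥0 | (threshold F τ : ℝ) < w} ⊆ ⋃ m : ℕ, {w : ℝ≥0 | (u m : ℝ) < w} := by
    intro w hw
    have : ∀ᶠ m in Filter.atTop, u m < w :=
      hlim.eventually (gt_mem_nhds (NNReal.coe_lt_coe.1 hw))
    obtain ⟨m, hm⟩ := this.exists
    exact Set.mem_iUnion.2 ⟨m, NNReal.coe_lt_coe.2 hm⟩
  exact (measureReal_mono hsub).trans (le_of_tendsto' h hmem)

lemma threshold_le_iff {τ : ℝ} (hτ : 0 < τ) (z : ℝ≥0) : threshold F τ ≤ z ↔ tail F z ≤ τ :=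
  ⟨fun h => (tail_antitone F (NNReal.coe_le_coe.2 h)).trans (tail_threshold_le F hτ),
    fun h => csInf_le ⟨0, fun _ _ => zero_le⟩ h⟩

lemma le_measureReal_Ici_threshold {τ : ℝ} (hτ : 0 < τ) (hτ1 : τ ≤ 1) :
    τ ≤ F.real (Set.Ici (threshold F τ)) := by
  rcases eq_or_ne (threshold F τ) 0 with h0 | h0
  · rw [h0, show Set.Ici (0 : ℝ≥0) = Set.univ from Set.eq_univ_of_forall fun _ => Set.mem_Ici.2 zero_le]
    simpa using hτ1
  obtain ⟨u, hu, hlt, hlim⟩ := exists_seq_strictMono_tendsto' (pos_iff_ne_zero.2 h0)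
  have he : Set.Ici (threshold F τ) = ⋂ m : ℕ, {w : ℝ≥0 | (u m : ℝ) < w} := by
    ext w
    simp only [Set.mem_Ici, Set.mem_iInter, Set.mem_ofPred_eq, NNReal.coe_lt_coe]
    exact ⟨fun h m => (hlt m).2.trans_le h, fun h => le_of_tendsto' hlim fun m => (h m).le⟩
  have h : Filter.Tendsto (fun m : ℕ => F.real {w : ℝ≥0 | (u m : ℝ) < w}) Filter.atTop
      (𝓝 (F.real (⋂ m : ℕ, {w : ℝ≥0 | (u m : ℝ) < w}))) := by
    refine (ENNReal.tendsto_toReal (measure_ne_top _ _)).comp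
      (tendsto_measure_iInter_atTop (fun m => (measurableSet_lt_coe _).nullMeasurableSet)
        (fun a b hab w hw => ?_) ⟨0, measure_ne_top _ _⟩)
    exact lt_of_le_of_lt (NNReal.coe_le_coe.2 (hu.monotone hab)) hw
  rw [he]
  refine ge_of_tendsto' h fun m => ?_
  exact (not_le.1 fun hc => (hlt m).2.not_ge ((threshold_le_iff F hτ _).2 hc)).le

/-- The probability, over the coin of the tie-breaking, that the value `v` has quantile at
most `τ`. -/
noncomputable def highProb (τ : ℝ) (v : ℝ≥0) : ℝ≥0∞ :=
  volume {t : unitInterval | quantile F (v, t) ≤ τ}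

lemma highProb_le_one (τ : ℝ) (v : ℝ≥0) : highProb F τ v ≤ 1 := prob_le_one

lemma measurableSet_quantile_le (τ : ℝ) : MeasurableSet {x | quantile F x ≤ τ} :=
  measurableSet_le (measurable_quantile F) measurable_const

lemma measurable_highProb (τ : ℝ) : Measurable (highProb F τ) :=
  measurable_measure_prodMk_left (measurableSet_quantile_le F τ)

lemma highProb_of_threshold_lt {τ : ℝ} (hτ : 0 < τ) {v : ℝ≥0} (hv : threshold F τ < v) :
    highProb F τ v = 1 := by
  have : {t : unitInterval | quantile F (v, t) ≤ τ} = Set.univ := by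
    refine Set.eq_univ_of_forall fun t => ?_
    exact (quantile_le_tail_of_lt F (x := (v, t)) (NNReal.coe_lt_coe.2 hv)).trans
      (tail_threshold_le F hτ)
  rw [highProb, this, measure_univ]

lemma highProb_of_lt_threshold {τ : ℝ} (hτ : 0 < τ) {v : ℝ≥0} (hv : v < threshold F τ) :
    highProb F τ v = 0 := by
  have : {t : unitInterval | quantile F (v, t) ≤ τ} = ∅ := by
    refine Set.eq_empty_of_forall_notMem fun t ht => ?_
    exact hv.not_ge ((threshold_le_iff F hτ v).2 ((tail_le_quantile F (v, t)).trans ht))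
  rw [highProb, this, measure_empty]

lemma highProb_threshold_mul {τ : ℝ} (hτ : 0 < τ) (hτ1 : τ ≤ 1) :
    highProb F τ (threshold F τ) * F {threshold F τ}
      = ENNReal.ofReal (τ - tail F (threshold F τ)) := by
  set z := threshold F τ with hz
  have h1 : tail F z ≤ τ := tail_threshold_le F hτ
  have h2 : τ ≤ tail F z + F.real {z} := by
    rw [tail_add_singleton]; exact le_measureReal_Ici_threshold F hτ hτ1
  rcases (measureReal_nonneg (μ := F) (s := {z})).eq_or_lt with h0 | h0
  · have : F {z} = 0 := (measureReal_eq_zero_iff).1 h0.symm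
    rw [this, mul_zero, eq_comm, ENNReal.ofReal_eq_zero]
    linarith
  · have hc : (τ - tail F z) / F.real {z} ∈ unitInterval :=
      ⟨div_nonneg (by linarith) h0.le, (div_le_one h0).2 (by linarith)⟩
    have : {t : unitInterval | quantile F (z, t) ≤ τ} = Set.Iic ⟨_, hc⟩ := by
      ext t
      simp only [quantile, Set.mem_ofPred_eq, Set.mem_Iic]
      rw [← Subtype.coe_le_coe, le_div_iff₀ h0]
      constructor <;> intro h <;> linarith
    rw [highProb, this, unitInterval.volume_Iic, ← ofReal_measureReal (μ := F) (s := {z}),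
      ← ENNReal.ofReal_mul hc.1, div_mul_cancel₀ _ h0.ne']

/-- The quantile of a random value is uniformly distributed, even if the distribution has atoms: the
coin splits an atom at the threshold exactly where the probability reaches `τ`. -/
lemma lintegral_highProb {τ : ℝ} (hτ : 0 < τ) (hτ1 : τ ≤ 1) :
    ∫⁻ v, highProb F τ v ∂F = ENNReal.ofReal τ := by
  set z := threshold F τ with hz
  have h : highProb F τ = fun v => {w : ℝ≥0 | (z : ℝ) < w}.indicator 1 v
      + ({z} : Set ℝ≥0).indicator (fun _ => highProb F τ z) v := by
    ext v
    rcases lt_trichotomy v z with h | h | h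
    · simp [highProb_of_lt_threshold F hτ h, h.not_gt, h.ne]
    · simp [h]
    · simp [highProb_of_threshold_lt F hτ h, h, h.ne']
  rw [h, lintegral_add_left (measurable_one.indicator (measurableSet_lt_coe _)),
    lintegral_indicator_one (measurableSet_lt_coe _),
    lintegral_indicator_const (measurableSet_singleton _), highProb_threshold_mul F hτ hτ1,
    ← ofReal_tail, ← ENNReal.ofReal_add (tail_nonneg F _)
      (sub_nonneg.2 (tail_threshold_le F hτ))]
  congr 1
  ring

lemma measure_quantile_le {τ : ℝ} (hτ : 0 < τ) (hτ1 : τ ≤ 1) :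
    (F.prod volume) {x | quantile F x ≤ τ} = ENNReal.ofReal τ := by
  rw [Measure.prod_apply (measurableSet_quantile_le F τ), ← lintegral_highProb F hτ hτ1]
  rfl

end Quantile

/-! ### Average values of top quantiles -/

section TopMean

variable (F : Measure ℝ≥0) [IsProbabilityMeasure F]

/-- The expected utility of an agent that is served exactly when it pays the threshold price of
quantile `τ`, written through the tail. -/
noncomputable def excess (τ : ℝ) : ℝ≥0∞ :=
  ∫⁻ z in Set.Ioi (0 : ℝ), {z | tail F z ≤ τ}.indicator (fun z => ENNReal.ofReal (tail F z)) z

/-- The average value of an agent over its quantiles below `s > 0`, written through the tail. -/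
noncomputable def topMean (s : ℝ) : ℝ≥0∞ :=
  ∫⁻ z in Set.Ioi (0 : ℝ), ENNReal.ofReal (min (tail F z / s) 1)

lemma lintegral_ofReal_sub (c : ℝ≥0) :
    ∫⁻ w : ℝ≥0, ENNReal.ofReal ((w : ℝ) - c) ∂F
      = ∫⁻ z in Set.Ioi (c : ℝ), ENNReal.ofReal (tail F z) := by
  have hm : MeasurableSet {p : ℝ≥0 × ℝ | p.2 < p.1} :=
    measurableSet_lt measurable_snd (measurable_coe_nnreal_real.comp measurable_fst)
  have h1 (w : ℝ≥0) : ENNReal.ofReal ((w : ℝ) - c)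
      = ∫⁻ z in Set.Ioi (c : ℝ), {p : ℝ≥0 × ℝ | p.2 < p.1}.indicator 1 (w, z) := by
    have : (fun z : ℝ => {p : ℝ≥0 × ℝ | p.2 < p.1}.indicator (1 : ℝ≥0 × ℝ → ℝ≥0∞) (w, z))
        = (Set.Iio (w : ℝ)).indicator 1 := by
      ext z; simp [Set.indicator_apply]
    rw [this, lintegral_indicator_one measurableSet_Iio, Measure.restrict_apply measurableSet_Iio,
      Set.inter_comm, Set.Ioi_inter_Iio, Real.volume_Ioo]
  simp_rw [h1]
  rw [lintegral_lintegral_swap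
    (Measurable.aemeasurable (by exact measurable_one.indicator hm))]
  refine lintegral_congr fun z => ?_
  rw [ofReal_tail, ← lintegral_indicator_one (measurableSet_lt_coe z)]
  rfl

lemma lintegral_coe_eq_tail :
    ∫⁻ w : ℝ≥0, (w : ℝ≥0∞) ∂F = ∫⁻ z in Set.Ioi (0 : ℝ), ENNReal.ofReal (tail F z) := by
  simpa using lintegral_ofReal_sub F 0

lemma topMean_anti {s t : ℝ} (hs : 0 < s) (hst : s ≤ t) : topMean F t ≤ topMean F s :=
  lintegral_mono fun z => ENNReal.ofReal_le_ofReal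
    (min_le_min_right _ (div_le_div_of_nonneg_left (tail_nonneg F z) hs hst))

/-- This includes `s = 0`, where the integrand is `0`. -/
lemma topMean_ne_top (hF : ∫⁻ w, (w : ℝ≥0∞) ∂F ≠ ∞) (s : ℝ) : topMean F s ≠ ∞ := by
  refine ne_top_of_le_ne_top (ENNReal.mul_ne_top hF (ENNReal.ofReal_ne_top (r := 1 / s))) ?_
  rw [lintegral_coe_eq_tail, ← lintegral_mul_const _ (measurable_tail F).ennreal_ofReal]
  refine lintegral_mono fun z => ?_
  rw [← ENNReal.ofReal_mul (tail_nonneg F z)]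
  refine ENNReal.ofReal_le_ofReal ((min_le_left _ _).trans_eq ?_)
  ring

lemma le_topMean_quantile {x : ℝ≥0 × unitInterval} (hx : 0 < quantile F x) :
    (x.1 : ℝ≥0∞) ≤ topMean F (quantile F x) := by
  calc (x.1 : ℝ≥0∞) = ∫⁻ z in Set.Ioi (0 : ℝ), (Set.Iio (x.1 : ℝ)).indicator 1 z := by
        rw [lintegral_indicator_one measurableSet_Iio, Measure.restrict_apply measurableSet_Iio,
          Set.inter_comm, Set.Ioi_inter_Iio, Real.volume_Ioo]
        simp
    _ ≤ _ := by
        refine lintegral_mono fun z => ?_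
        by_cases hz : z < x.1
        · have : 1 ≤ tail F z / quantile F x :=
            (one_le_div hx).2 (quantile_le_tail_of_lt F hz)
          simp [hz, min_eq_right this]
        · simp [hz]

lemma setLIntegral_quantile_le_le {ε : ℝ} (hε : 0 < ε) (hε1 : ε ≤ 1) :
    ∫⁻ x in {x | quantile F x ≤ ε}, (x.1 : ℝ≥0∞) ∂(F.prod volume)
      ≤ ENNReal.ofReal ε * topMean F ε := by
  have hmc : Measurable fun x : ℝ≥0 × unitInterval => (x.1 : ℝ) :=
    measurable_coe_nnreal_real.comp measurable_fst
  have h := lintegral_eq_lintegral_meas_lt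
    ((F.prod (volume : Measure unitInterval)).restrict {x | quantile F x ≤ ε})
    (f := fun x => (x.1 : ℝ)) (.of_forall fun x => x.1.coe_nonneg) hmc.aemeasurable
  simp only [ENNReal.ofReal_coe_nnreal] at h
  rw [h, topMean, ← lintegral_const_mul _
    (((measurable_tail F).div_const _).min measurable_const).ennreal_ofReal]
  refine lintegral_mono fun z => ?_
  rw [← ENNReal.ofReal_mul hε.le, mul_min_of_nonneg _ _ hε.le, mul_one, mul_div_cancel₀ _ hε.ne',
    ENNReal.ofReal_min]
  refine le_min ?_ ?_
  · refine (Measure.restrict_apply_le _ _).trans_eq ?_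
    have : {x : ℝ≥0 × unitInterval | z < x.1} = {w : ℝ≥0 | z < w} ×ˢ Set.univ := by
      ext x; simp
    rw [this, Measure.prod_prod, measure_univ, mul_one, ofReal_tail]
  · refine (measure_mono (Set.subset_univ _)).trans_eq ?_
    rw [Measure.restrict_apply_univ, measure_quantile_le F hε hε1]

lemma setLIntegral_Ioo_ofReal_deriv {f f' : ℝ → ℝ} {a b : ℝ} (ha : 0 < a) (hab : a ≤ b)
    (hf : ∀ x, 0 < x → HasDerivAt f (f' x) x) (hf' : ContinuousOn f' (Set.Ioi 0))
    (hpos : ∀ x, 0 < x → 0 ≤ f' x) :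
    ∫⁻ τ in Set.Ioo a b, ENNReal.ofReal (f' τ) = ENNReal.ofReal (f b - f a) := by
  have hsub : Set.uIcc a b ⊆ Set.Ioi 0 := by
    rw [Set.uIcc_of_le hab]; exact fun x hx => ha.trans_le hx.1
  have hint : IntervalIntegrable f' volume a b := (hf'.mono hsub).intervalIntegrable
  rw [← intervalIntegral.integral_eq_sub_of_hasDerivAt (fun x hx => hf x (hsub hx)) hint,
    intervalIntegral.integral_of_le hab, setLIntegral_congr Ioo_ae_eq_Ioc]
  refine (ofReal_integral_eq_lintegral_ofReal
    ((intervalIntegrable_iff_integrableOn_Ioc_of_le hab).1 hint) ?_).symm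
  filter_upwards [ae_restrict_mem measurableSet_Ioc] with x hx
  exact hpos x (ha.trans hx.1)

lemma setLIntegral_Ioo_inv {a : ℝ} (ha : 0 < a) (ha1 : a ≤ 1) :
    ∫⁻ τ in Set.Ioo a 1, ENNReal.ofReal τ⁻¹ = ENNReal.ofReal (-Real.log a) := by
  rw [setLIntegral_Ioo_ofReal_deriv (f := Real.log) ha ha1
    (fun x hx => Real.hasDerivAt_log hx.ne')
    (continuousOn_inv₀.mono fun x hx => (Set.mem_Ioi.1 hx).ne') fun x hx => (inv_pos.2 hx).le]
  simp

lemma setLIntegral_Ioo_inv_sq {a : ℝ} (ha : 0 < a) (ha1 : a ≤ 1) :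
    ∫⁻ τ in Set.Ioo a 1, ENNReal.ofReal (τ ^ 2)⁻¹ = ENNReal.ofReal (a⁻¹ - 1) := by
  rw [setLIntegral_Ioo_ofReal_deriv (f := fun x => -x⁻¹) (f' := fun x => (x ^ 2)⁻¹) ha ha1
    (fun x hx => by simpa using (hasDerivAt_inv hx.ne').fun_neg)
    ((continuousOn_pow 2).inv₀ fun x hx => (pow_pos hx 2).ne')
    fun x hx => (inv_pos.2 (pow_pos hx 2)).le]
  congr 1
  rw [inv_one]
  ring

lemma aemeasurable_excess_mul (ε : ℝ) :
    AEMeasurable (Function.uncurry fun (τ z : ℝ) => {p : ℝ × ℝ | tail F p.2 ≤ p.1}.indicator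
      (fun p => ENNReal.ofReal (p.1 ^ 2)⁻¹ * ENNReal.ofReal (tail F p.2)) (τ, z))
      ((volume.restrict (Set.Ioo ε 1)).prod (volume.restrict (Set.Ioi 0))) := by
  refine Measurable.aemeasurable ?_
  exact Measurable.indicator ((measurable_fst.pow_const 2).inv.ennreal_ofReal.mul
    ((measurable_tail F).comp measurable_snd).ennreal_ofReal)
    (measurableSet_le ((measurable_tail F).comp measurable_snd) measurable_fst)

lemma measurable_excess : Measurable (excess F) := by
  have h : Measurable fun p : ℝ × ℝ => {p : ℝ × ℝ | tail F p.2 ≤ p.1}.indicator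
      (fun p => ENNReal.ofReal (tail F p.2)) p :=
    Measurable.indicator ((measurable_tail F).comp measurable_snd).ennreal_ofReal
      (measurableSet_le ((measurable_tail F).comp measurable_snd) measurable_fst)
  exact h.lintegral_prod_right' (ν := volume.restrict (Set.Ioi 0))

lemma excess_eq {τ : ℝ} (hτ : 0 < τ) :
    excess F τ = ∫⁻ w, ENNReal.ofReal ((w : ℝ) - threshold F τ) ∂F := by
  have hm : MeasurableSet {z | tail F z ≤ τ} := measurableSet_le (measurable_tail F) measurable_const
  have hset : ({z | tail F z ≤ τ} ∩ Set.Ioi 0 : Set ℝ) =ᵐ[volume] Set.Ioi (threshold F τ : ℝ) := by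
    refine Filter.EventuallyEq.trans ?_ (Ioi_ae_eq_Ici (a := (threshold F τ : ℝ))).symm
    have h0 : ∀ᵐ z : ℝ, z ≠ 0 := by simp [ae_iff]
    filter_upwards [h0] with z hz
    refine propext ⟨fun h => ?_, fun h => ?_⟩
    · have := (threshold_le_iff F hτ ⟨z, le_of_lt h.2⟩).2 h.1
      exact NNReal.coe_le_coe.2 this
    · have hz0 : 0 ≤ z := (threshold F τ).coe_nonneg.trans h
      exact ⟨(threshold_le_iff F hτ ⟨z, hz0⟩).1 (NNReal.coe_le_coe.1 h), hz0.lt_of_ne' hz⟩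
  rw [excess, lintegral_ofReal_sub, setLIntegral_indicator hm, setLIntegral_congr hset]

/-- The average value of the top quantiles is recovered from the utilities of the threshold
mechanisms, the weight `1 / τ²` being what turns a tail probability `g` into
`min (g / s) 1 = g + ∫_s^1 1{g ≤ τ} g / τ² dτ`. -/
lemma topMean_le {s : ℝ} (hs : 0 < s) (hs1 : s ≤ 1) :
    topMean F s ≤ ∫⁻ w, (w : ℝ≥0∞) ∂F
      + ∫⁻ τ in Set.Ioo s 1, ENNReal.ofReal (τ ^ 2)⁻¹ * excess F τ := by
  have h1 : ∫⁻ τ in Set.Ioo s 1, ENNReal.ofReal (τ ^ 2)⁻¹ * excess F τ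
      = ∫⁻ z in Set.Ioi (0 : ℝ), ∫⁻ τ in Set.Ioo s 1, {p : ℝ × ℝ | tail F p.2 ≤ p.1}.indicator
      (fun p => ENNReal.ofReal (p.1 ^ 2)⁻¹ * ENNReal.ofReal (tail F p.2)) (τ, z) := by
    rw [← lintegral_lintegral_swap (aemeasurable_excess_mul F s)]
    refine setLIntegral_congr_fun measurableSet_Ioo fun τ hτ => ?_
    rw [excess, ← lintegral_const_mul _
      ((measurable_tail F).ennreal_ofReal.indicator
        (measurableSet_le (measurable_tail F) measurable_const))]
    refine lintegral_congr fun z => ?_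
    by_cases hz : tail F z ≤ τ <;> simp [hz]
  rw [h1, lintegral_coe_eq_tail, ← lintegral_add_left (measurable_tail F).ennreal_ofReal]
  refine lintegral_mono fun z => ?_
  set g := tail F z with hg
  have hg0 : 0 ≤ g := tail_nonneg F z
  have hg1 : g ≤ 1 := tail_le_one F z
  have hm0 : 0 < max g s := hs.trans_le (le_max_right _ _)
  calc ENNReal.ofReal (min (g / s) 1)
      ≤ ENNReal.ofReal g + ENNReal.ofReal ((max g s)⁻¹ - 1) * ENNReal.ofReal g := by
        rw [← ENNReal.ofReal_mul (sub_nonneg.2 ((one_le_inv₀ hm0).2 (max_le hg1 hs1))),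
          ← ENNReal.ofReal_add hg0 (mul_nonneg
            (sub_nonneg.2 ((one_le_inv₀ hm0).2 (max_le hg1 hs1))) hg0)]
        refine ENNReal.ofReal_le_ofReal ?_
        rcases le_total g s with h | h
        · rw [max_eq_right h]
          refine (min_le_left _ _).trans_eq ?_
          ring
        · rw [max_eq_left h]
          refine (min_le_right _ _).trans_eq ?_
          have : g ≠ 0 := (hs.trans_le h).ne'
          field_simp
          ring
    _ ≤ _ := by
        gcongr
        rw [← setLIntegral_Ioo_inv_sq hm0 (max_le hg1 hs1),
          ← lintegral_mul_const _ (by fun_prop)]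
        calc _ = ∫⁻ τ in Set.Ioo (max g s) 1, {p : ℝ × ℝ | tail F p.2 ≤ p.1}.indicator
                (fun p => ENNReal.ofReal (p.1 ^ 2)⁻¹ * ENNReal.ofReal (tail F p.2)) (τ, z) := by
              refine setLIntegral_congr_fun measurableSet_Ioo fun τ hτ => ?_
              have : tail F z ≤ τ := (le_max_left _ _).trans hτ.1.le
              simp [this, hg]
          _ ≤ _ := lintegral_mono_set (Set.Ioo_subset_Ioo_left (le_max_right _ _))

end TopMean

/-! ### Threshold mechanisms -/

section ThresholdResampling

variable (F : Measure ℝ≥0) [IsProbabilityMeasure F] {τ : ℝ}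

lemma lintegral_one_sub_highProb (hτ : 0 < τ) (hτ1 : τ ≤ 1) :
    ∫⁻ v, (1 - highProb F τ v) ∂F = ENNReal.ofReal (1 - τ) := by
  rw [lintegral_sub (measurable_highProb F τ)
    (by rw [lintegral_highProb F hτ hτ1]; exact ENNReal.ofReal_ne_top)
    (.of_forall (highProb_le_one F τ)), lintegral_highProb F hτ hτ1, lintegral_one, measure_univ,
    ENNReal.ofReal_sub _ hτ.le, ENNReal.ofReal_one]

lemma measure_compl_quantile_le (hτ : 0 < τ) (hτ1 : τ ≤ 1) :
    (F.prod volume) {x | quantile F x ≤ τ}ᶜ = ENNReal.ofReal (1 - τ) := by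
  rw [prob_compl_eq_one_sub (measurableSet_quantile_le F τ), measure_quantile_le F hτ hτ1,
    ENNReal.ofReal_sub _ hτ.le, ENNReal.ofReal_one]

/-- Tell only whether the quantile of the value is at most `τ`, and redraw a value together with
its tie-breaking coin conditionally on this one bit. -/
noncomputable def thresholdResampling (hτ : 0 < τ) (hτ1 : τ < 1) :
    Resampling F (F.prod (volume : Measure unitInterval)) where
  density v x := {x | quantile F x ≤ τ}.indicator (fun _ => highProb F τ v / ENNReal.ofReal τ) x
    + {x | quantile F x ≤ τ}ᶜ.indicator
      (fun _ => (1 - highProb F τ v) / ENNReal.ofReal (1 - τ)) x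
  measurable_density := by
    have hS : MeasurableSet {p : ℝ≥0 × (ℝ≥0 × unitInterval) | quantile F p.2 ≤ τ} :=
      measurable_snd (measurableSet_quantile_le F τ)
    have hH : Measurable fun p : ℝ≥0 × (ℝ≥0 × unitInterval) => highProb F τ p.1 :=
      (measurable_highProb F τ).comp measurable_fst
    exact ((hH.div_const _).indicator hS).add
      (((measurable_const.sub hH).div_const _).indicator hS.compl)
  lintegral_type v := by
    have hS := measurableSet_quantile_le F τ
    rw [lintegral_add_left (measurable_const.indicator hS), lintegral_indicator_const hS,
      lintegral_indicator_const hS.compl, measure_quantile_le F hτ hτ1.le,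
      measure_compl_quantile_le F hτ hτ1.le,
      ENNReal.div_mul_cancel (by simpa using hτ) ENNReal.ofReal_ne_top,
      ENNReal.div_mul_cancel (by simpa using hτ1) ENNReal.ofReal_ne_top]
    exact add_tsub_cancel_of_le (highProb_le_one F τ v)
  lintegral_value x := by
    by_cases hx : quantile F x ≤ τ
    · simp only [Set.indicator_apply, Set.mem_ofPred_eq, hx, if_true, Set.mem_compl_iff,
        not_true_eq_false, if_false, add_zero, div_eq_mul_inv]
      rw [lintegral_mul_const _ (measurable_highProb F τ), lintegral_highProb F hτ hτ1.le]
      exact ENNReal.mul_inv_cancel (by simpa using hτ) ENNReal.ofReal_ne_top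
    · simp only [Set.indicator_apply, Set.mem_ofPred_eq, hx, if_true, Set.mem_compl_iff,
        not_false_eq_true, if_false, zero_add, div_eq_mul_inv]
      rw [lintegral_mul_const _ ((measurable_highProb F τ).const_sub 1),
        lintegral_one_sub_highProb F hτ hτ1.le]
      exact ENNReal.mul_inv_cancel (by simpa using hτ1) ENNReal.ofReal_ne_top

lemma lintegral_thresholdResampling_mul (hτ : 0 < τ) (hτ1 : τ < 1) (v : ℝ≥0)
    {y : ℝ≥0 × unitInterval → ℝ≥0∞} (hy : Measurable y) :
    ∫⁻ x, (thresholdResampling F hτ hτ1).density v x * y x ∂(F.prod volume)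
      = highProb F τ v * ((∫⁻ x in {x | quantile F x ≤ τ}, y x ∂(F.prod volume))
          / ENNReal.ofReal τ)
        + (1 - highProb F τ v) * ((∫⁻ x in {x | quantile F x ≤ τ}ᶜ, y x ∂(F.prod volume))
          / ENNReal.ofReal (1 - τ)) := by
  have hS := measurableSet_quantile_le F τ
  rw [← lintegral_add_compl _ hS]
  congr 1
  · rw [← ENNReal.mul_comm_div, ← lintegral_const_mul _ hy]
    refine setLIntegral_congr_fun hS fun x hx => ?_
    have hx' : quantile F x ≤ τ := hx
    simp [thresholdResampling, hx']
  · rw [← ENNReal.mul_comm_div, ← lintegral_const_mul _ hy]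
    refine setLIntegral_congr_fun hS.compl fun x hx => ?_
    have hx' : ¬ quantile F x ≤ τ := hx
    simp [thresholdResampling, hx']

/-- A function that decreases with the quantile has a larger average over small quantiles than over
large ones. -/
lemma average_compl_le_average (hτ : 0 < τ) (hτ1 : τ < 1)
    {y : ℝ≥0 × unitInterval → ℝ≥0∞} (hy : Measurable y)
    (hanti : ∀ x x', quantile F x ≤ quantile F x' → y x' ≤ y x) :
    (∫⁻ x in {x | quantile F x ≤ τ}ᶜ, y x ∂(F.prod volume)) / ENNReal.ofReal (1 - τ)
      ≤ (∫⁻ x in {x | quantile F x ≤ τ}, y x ∂(F.prod volume)) / ENNReal.ofReal τ := by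
  have hS := measurableSet_quantile_le F τ
  set c : ℝ≥0∞ := ⨆ x ∈ {x | quantile F x ≤ τ}ᶜ, y x with hc
  trans c
  · refine ENNReal.div_le_of_le_mul ?_
    rw [← measure_compl_quantile_le F hτ hτ1.le, ← setLIntegral_const]
    exact setLIntegral_mono measurable_const fun x hx => le_iSup₂_of_le x hx le_rfl
  · rw [ENNReal.le_div_iff_mul_le (.inl (by simpa using hτ)) (.inl ENNReal.ofReal_ne_top),
      ← measure_quantile_le F hτ hτ1.le, ← setLIntegral_const]
    refine setLIntegral_mono hy fun x hx => iSup₂_le fun x' hx' => hanti x x' ?_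
    exact le_trans (show quantile F x ≤ τ from hx) (not_le.1 (show ¬ quantile F x' ≤ τ from hx')).le

end ThresholdResampling

namespace Env

variable {n : ℕ} {E : Env n}

variable (E) in
/-- The law of a value together with an independent uniform tie-breaking coin. -/
noncomputable abbrev typeLaw (i : Fin n) : Measure (ℝ≥0 × unitInterval) :=
  (E.dist i).prod volume

variable (a : E.SelectionRule (ℝ≥0 × unitInterval))

/-- Ignoring the reports and running the rule on fresh random types needs no payments. -/
lemma sum_selectProb_mul_mean_le :
    ∑ i, (∫⁻ x, a.selectProb E.typeLaw i x ∂E.typeLaw i) * ∫⁻ w, (w : ℝ≥0∞) ∂E.dist i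
      ≤ E.optConsumerSurplus := by
  let k (i : Fin n) : Resampling (E.dist i) (E.typeLaw i) :=
    { density := fun _ _ => 1
      measurable_density := measurable_const
      lintegral_type := fun _ => by simp
      lintegral_value := fun _ => by simp }
  set Y : Fin n → ℝ≥0∞ := fun i => ∫⁻ x, a.selectProb E.typeLaw i x ∂E.typeLaw i with hY
  have hY1 (i) : Y i ≠ ∞ := by
    refine ne_top_of_le_ne_top ENNReal.one_ne_top ?_
    refine (lintegral_mono (a.selectProb_le_one i)).trans_eq ?_
    simp
  have halloc (i) (r) : (a.resampled k).interimAlloc i r = (Y i).toReal := by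
    rw [a.interimAlloc_resampled k]
    simp [k, hY]
  refine le_trans (le_of_eq ?_) ((a.resampled k).sum_lintegral_utility_le_optConsumerSurplus
    (fun i r => r * (Y i).toReal) (fun i => by simp)
    (fun i => measurable_coe_nnreal_real.mul_const _)
    (fun i => by
      rw [show (a.resampled k).interimAlloc i = fun _ => (Y i).toReal from funext (halloc i)]
      exact measurable_const)
    (fun i x r => by rw [halloc]; exact (sub_mul _ _ _).le))
  refine Finset.sum_congr rfl fun i _ => ?_
  rw [mul_comm, ← lintegral_mul_const _ measurable_coe_nnreal_ennreal]
  refine lintegral_congr fun r => ?_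
  rw [ENNReal.ofReal_mul r.coe_nonneg, ENNReal.ofReal_coe_nnreal, ENNReal.ofReal_toReal (hY1 i)]

/-- The mechanism with threshold quantile `τ` serves an agent more often when its value is high,
and leaves it at least the utility of paying the threshold price for this better
service. -/
lemma sum_selectProb_mul_excess_le {τ : ℝ} (hτ : 0 < τ) (hτ1 : τ < 1)
    (hanti : ∀ i x x', quantile (E.dist i) x ≤ quantile (E.dist i) x' →
      a.selectProb E.typeLaw i x' ≤ a.selectProb E.typeLaw i x) :
    ∑ i, (∫⁻ x in {x | quantile (E.dist i) x ≤ τ}, a.selectProb E.typeLaw i x ∂E.typeLaw i)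
        / ENNReal.ofReal τ * excess (E.dist i) τ
      ≤ E.optConsumerSurplus := by
  let k (i : Fin n) : Resampling (E.dist i) (E.typeLaw i) := thresholdResampling (E.dist i) hτ hτ1
  set h : Fin n → ℝ≥0∞ := fun i =>
    (∫⁻ x in {x | quantile (E.dist i) x ≤ τ}, a.selectProb E.typeLaw i x ∂E.typeLaw i)
      / ENNReal.ofReal τ with hh
  set l : Fin n → ℝ≥0∞ := fun i =>
    (∫⁻ x in {x | quantile (E.dist i) x ≤ τ}ᶜ, a.selectProb E.typeLaw i x ∂E.typeLaw i)
      / ENNReal.ofReal (1 - τ) with hl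
  have hlh (i) : l i ≤ h i :=
    average_compl_le_average (E.dist i) hτ hτ1 (a.measurable_selectProb i) (hanti i)
  have hh_top (i) : h i ≠ ∞ := by
    refine ne_top_of_le_ne_top ENNReal.one_ne_top (ENNReal.div_le_of_le_mul ?_)
    rw [← measure_quantile_le (E.dist i) hτ hτ1.le, one_mul, ← setLIntegral_one]
    exact lintegral_mono (a.selectProb_le_one i)
  have hl_top (i) : l i ≠ ∞ := ne_top_of_le_ne_top (hh_top i) (hlh i)
  have hlh' (i) : (l i).toReal ≤ (h i).toReal := ENNReal.toReal_mono (hh_top i) (hlh i)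
  have hH_top (i) (r) : highProb (E.dist i) τ r ≠ ∞ :=
    ne_top_of_le_ne_top ENNReal.one_ne_top (highProb_le_one _ _ _)
  have halloc (i) (r) : (a.resampled k).interimAlloc i r
      = (highProb (E.dist i) τ r).toReal * (h i).toReal
        + (1 - (highProb (E.dist i) τ r).toReal) * (l i).toReal := by
    rw [a.interimAlloc_resampled k, lintegral_thresholdResampling_mul (E.dist i) hτ hτ1 r
      (a.measurable_selectProb i), ENNReal.toReal_add
      (ENNReal.mul_ne_top (hH_top i r) (hh_top i))
      (ENNReal.mul_ne_top (ENNReal.sub_ne_top ENNReal.one_ne_top) (hl_top i)),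
      ENNReal.toReal_mul, ENNReal.toReal_mul,
      ENNReal.toReal_sub_of_le (highProb_le_one _ _ _) ENNReal.one_ne_top, ENNReal.toReal_one]
  set u : Fin n → ℝ≥0 → ℝ := fun i r => (l i).toReal * r
    + ((h i).toReal - (l i).toReal) * max ((r : ℝ) - threshold (E.dist i) τ) 0 with hu
  have hH_meas (i) : Measurable fun r => (highProb (E.dist i) τ r).toReal :=
    (measurable_highProb (E.dist i) τ).ennreal_toReal
  refine le_trans (Finset.sum_le_sum fun i _ => ?_)
    ((a.resampled k).sum_lintegral_utility_le_optConsumerSurplus u (fun i => ?_) (fun i => ?_)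
    (fun i => ?_) (fun i x r => ?_))
  · rw [excess_eq _ hτ, ← lintegral_const_mul _ (by fun_prop)]
    refine lintegral_mono fun r => ?_
    change h i * _ ≤ _
    rw [← ENNReal.ofReal_toReal (hh_top i), ← ENNReal.ofReal_mul ENNReal.toReal_nonneg]
    refine ENNReal.ofReal_le_ofReal ?_
    have h1 : (h i).toReal * ((r : ℝ) - threshold (E.dist i) τ)
        ≤ (h i).toReal * max ((r : ℝ) - threshold (E.dist i) τ) 0 :=
      mul_le_mul_of_nonneg_left (le_max_left _ _) ENNReal.toReal_nonneg
    have h2 : max ((r : ℝ) - threshold (E.dist i) τ) 0 ≤ r :=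
      max_le (sub_le_self _ (NNReal.coe_nonneg _)) r.coe_nonneg
    have h3 := mul_le_mul_of_nonneg_left h2 (ENNReal.toReal_nonneg (a := l i))
    simp only [hu]
    linarith
  · simp [hu]
  · simp only [hu]; fun_prop
  · rw [show (a.resampled k).interimAlloc i = _ from funext (halloc i)]
    exact ((hH_meas i).mul_const _).add ((measurable_const.sub (hH_meas i)).mul_const _)
  · -- `max (r - t) 0` is convex with subgradient `1` above, `0` below, and anything between at `t`
    rw [halloc]
    have hsub : ((x : ℝ) - r) * (highProb (E.dist i) τ r).toReal
        ≤ max ((x : ℝ) - threshold (E.dist i) τ) 0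
          - max ((r : ℝ) - threshold (E.dist i) τ) 0 := by
      rcases lt_trichotomy r (threshold (E.dist i) τ) with hr | hr | hr
      · rw [highProb_of_lt_threshold _ hτ hr, ENNReal.toReal_zero, mul_zero,
          max_eq_right (sub_nonpos.2 (NNReal.coe_le_coe.2 hr.le)), sub_zero]
        exact le_max_right _ _
      · rw [← hr, sub_self, max_self, sub_zero]
        have h0 : 0 ≤ (highProb (E.dist i) τ r).toReal := ENNReal.toReal_nonneg
        have h1 : (highProb (E.dist i) τ r).toReal ≤ 1 :=
          ENNReal.toReal_mono ENNReal.one_ne_top (highProb_le_one _ _ _)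
        rcases le_total (x : ℝ) r with hx | hx
        · exact (mul_nonpos_of_nonpos_of_nonneg (sub_nonpos.2 hx) h0).trans (le_max_right _ _)
        · exact (mul_le_of_le_one_right (sub_nonneg.2 hx) h1).trans (le_max_left _ _)
      · rw [highProb_of_threshold_lt _ hτ hr, ENNReal.toReal_one, mul_one,
          max_eq_left (a := (r : ℝ) - _) (sub_nonneg.2 (NNReal.coe_le_coe.2 hr.le))]
        linarith [le_max_left ((x : ℝ) - threshold (E.dist i) τ) 0]
    have := mul_le_mul_of_nonneg_left hsub (sub_nonneg.2 (hlh' i))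
    simp only [hu]
    linarith

end Env

/-! ### Selecting the best feasible set -/

namespace Env

variable {n : ℕ} (E : Env n) {X : Type*} [MeasurableSpace X]

/-- The key by which feasible sets are compared: the total score, ties being broken by a fixed
numbering of the sets. -/
noncomputable def selectionKey (φ : Fin n → X → ℝ) (x : Fin n → X) (S : Finset (Fin n)) :
    ℝ ×ₗ ℕ :=
  toLex (∑ i ∈ S, φ i (x i), Encodable.encode S)

lemma selectionKey_le_iff (φ : Fin n → X → ℝ) (x : Fin n → X) (S T : Finset (Fin n)) :
    selectionKey φ x T ≤ selectionKey φ x S ↔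
      ∑ i ∈ T, φ i (x i) < ∑ i ∈ S, φ i (x i) ∨
        ∑ i ∈ T, φ i (x i) = ∑ i ∈ S, φ i (x i) ∧ Encodable.encode T ≤ Encodable.encode S :=
  Prod.Lex.toLex_le_toLex

lemma exists_max_selectionKey (φ : Fin n → X → ℝ) (x : Fin n → X) :
    ∃ S ∈ E.feasible, ∀ T ∈ E.feasible, selectionKey φ x T ≤ selectionKey φ x S :=
  E.feasible.exists_max_image _ E.feasible_nonempty

lemma eq_of_selectionKey_le {φ : Fin n → X → ℝ} {x : Fin n → X} {S T : Finset (Fin n)}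
    (h : selectionKey φ x S ≤ selectionKey φ x T) (h' : selectionKey φ x T ≤ selectionKey φ x S) :
    S = T :=
  Encodable.encode_injective (congrArg (fun p => (ofLex p).2) (le_antisymm h h'))

/-- The rule that selects the feasible set of largest total score. -/
noncomputable def maxRule (φ : Fin n → X → ℝ) (hφ : ∀ i, Measurable (φ i)) :
    E.SelectionRule X where
  select x := (E.exists_max_selectionKey φ x).choose
  select_mem x := (E.exists_max_selectionKey φ x).choose_spec.1
  measurableSet_select S := by
    by_cases hS : S ∈ E.feasible
    · have : (fun x => (E.exists_max_selectionKey φ x).choose) ⁻¹' {S}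
          = ⋂ T ∈ E.feasible, {x | selectionKey φ x T ≤ selectionKey φ x S} := by
        ext x
        obtain ⟨h1, h2⟩ := (E.exists_max_selectionKey φ x).choose_spec
        simp only [Set.mem_preimage, Set.mem_singleton_iff, Set.mem_iInter, Set.mem_ofPred_eq]
        refine ⟨fun h => h ▸ h2, fun h => eq_of_selectionKey_le (h _ h1) (h2 S hS)⟩
      rw [this]
      have hm (T : Finset (Fin n)) : Measurable fun x : Fin n → X => ∑ i ∈ T, φ i (x i) :=
        Finset.measurable_fun_sum _ fun i _ => (hφ i).comp (measurable_pi_apply i)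
      refine E.feasible.measurableSet_biInter fun T _ => ?_
      simp_rw [selectionKey_le_iff]
      exact (measurableSet_lt (hm T) (hm S)).union
        ((measurableSet_eq_fun (hm T) (hm S)).inter (MeasurableSet.const _))
    · have : (fun x => (E.exists_max_selectionKey φ x).choose) ⁻¹' {S} = ∅ := by
        refine Set.eq_empty_of_forall_notMem fun x hx => hS ?_
        rw [← show (E.exists_max_selectionKey φ x).choose = S from hx]
        exact (E.exists_max_selectionKey φ x).choose_spec.1
      rw [this]
      exact MeasurableSet.empty

variable {φ : Fin n → X → ℝ} (hφ : ∀ i, Measurable (φ i))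

lemma selectionKey_le_maxRule (x : Fin n → X) {T : Finset (Fin n)} (hT : T ∈ E.feasible) :
    selectionKey φ x T ≤ selectionKey φ x ((E.maxRule φ hφ).select x) :=
  (E.exists_max_selectionKey φ x).choose_spec.2 T hT

lemma sum_le_sum_maxRule (x : Fin n → X) {T : Finset (Fin n)} (hT : T ∈ E.feasible) :
    ∑ i ∈ T, φ i (x i) ≤ ∑ i ∈ (E.maxRule φ hφ).select x, φ i (x i) := by
  rcases (selectionKey_le_iff φ x _ _).1 (E.selectionKey_le_maxRule hφ x hT) with h | h
  · exact h.le
  · exact h.1.le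

/-- Raising the score of a selected agent keeps it selected. -/
lemma mem_maxRule_update {x : Fin n → X} {i : Fin n} {s : X} (hs : φ i (x i) ≤ φ i s)
    (hi : i ∈ (E.maxRule φ hφ).select x) :
    i ∈ (E.maxRule φ hφ).select (Function.update x i s) := by
  set S := (E.maxRule φ hφ).select x with hS
  set x' := Function.update x i s with hx'
  set S' := (E.maxRule φ hφ).select x' with hS'
  by_contra hi'
  have h1 : ∑ j ∈ S', φ j (x' j) = ∑ j ∈ S', φ j (x j) := by
    refine Finset.sum_congr rfl fun j hj => ?_
    rw [hx', Function.update_of_ne fun h => hi' (by rwa [h] at hj)]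
  have h2 : ∑ j ∈ S, φ j (x j) ≤ ∑ j ∈ S, φ j (x' j) := by
    refine Finset.sum_le_sum fun j _ => ?_
    by_cases hj : j = i
    · subst hj; simpa [hx'] using hs
    · rw [hx', Function.update_of_ne hj]
  have k1 := E.selectionKey_le_maxRule hφ x ((E.maxRule φ hφ).select_mem x')
  have k2 := E.selectionKey_le_maxRule hφ x' ((E.maxRule φ hφ).select_mem x)
  rw [← hS, ← hS'] at k1 k2
  rw [selectionKey_le_iff] at k1 k2
  rw [h1] at k2
  have : S = S' := by
    rcases k1 with k1 | ⟨k1, e1⟩ <;> rcases k2 with k2 | ⟨k2, e2⟩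
    · linarith
    · linarith
    · linarith
    · exact Encodable.encode_injective (le_antisymm e2 e1)
  exact hi' (this ▸ hi)

end Env

/-! ### Truncating high types -/

section Truncation

variable {n : ℕ} {X : Type*} [MeasurableSpace X]

/-- The largest total of `g` over a set of the family `P`. -/
noncomputable def maxTotal (P : Finset (Finset (Fin n))) (g : Fin n → ℝ≥0∞) : ℝ≥0∞ :=
  P.sup fun S => ∑ i ∈ S, g i

lemma maxTotal_mono (P : Finset (Finset (Fin n))) {f g : Fin n → ℝ≥0∞} (h : ∀ i, f i ≤ g i) :
    maxTotal P f ≤ maxTotal P g :=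
  Finset.sup_mono_fun fun _ _ => Finset.sum_le_sum fun i _ => h i

lemma sum_le_maxTotal {P : Finset (Finset (Fin n))} {S : Finset (Fin n)} (hS : S ∈ P)
    (g : Fin n → ℝ≥0∞) : ∑ i ∈ S, g i ≤ maxTotal P g :=
  Finset.le_sup (f := fun S => ∑ i ∈ S, g i) hS

lemma maxTotal_le_sum (P : Finset (Finset (Fin n))) (g : Fin n → ℝ≥0∞) :
    maxTotal P g ≤ ∑ i, g i :=
  Finset.sup_le fun _ _ => Finset.sum_le_sum_of_subset (Finset.subset_univ _)

lemma measurable_maxTotal (P : Finset (Finset (Fin n))) : Measurable (maxTotal P) := by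
  have : maxTotal P = fun g => ⨆ S ∈ P, ∑ i ∈ S, g i := by
    ext g; exact Finset.sup_eq_iSup _ _
  rw [this]
  exact Measurable.biSup _ P.countable_toSet fun S _ =>
    Finset.measurable_fun_sum _ fun i _ => measurable_pi_apply i

lemma one_sub_mul_le_of_le_add {a b c : ℝ≥0∞} (ha : a ≠ ∞) (h : a ≤ b + c * a) :
    (1 - c) * a ≤ b := by
  rw [ENNReal.sub_mul fun _ _ => ha, one_mul]
  exact tsub_le_iff_right.2 h

variable (μ : Fin n → Measure X) [∀ i, IsProbabilityMeasure (μ i)]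

/-- Replacing the values on a high set of probability at most `ε` per agent by others of at least
the same mean costs at most a factor `1 - n ε` of the optimal total. High types are so rare
that they contribute to the optimum like agents who never meet competition of their kind:
conditionally on an agent being the only one with a high type, it can be served at will. -/
lemma one_sub_mul_lintegral_maxTotal_le (P : Finset (Finset (Fin n))) {ε : ℝ≥0∞}
    {H : Fin n → Set X} (hH : ∀ i, MeasurableSet (H i)) (hHε : ∀ i, μ i (H i) ≤ ε)
    {val ψ : Fin n → X → ℝ≥0∞} (hval : ∀ i, Measurable (val i)) (hψ : ∀ i, Measurable (ψ i))
    (hval_top : ∀ i, ∫⁻ s, val i s ∂μ i ≠ ∞) (hψ_top : ∀ i, ∫⁻ s, ψ i s ∂μ i ≠ ∞)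
    (hlow : ∀ i, ∀ s ∉ H i, val i s ≤ ψ i s)
    (hhigh : ∀ i, ∫⁻ s in H i, val i s ∂μ i ≤ ∫⁻ s in H i, ψ i s ∂μ i) :
    (1 - n * ε) * ∫⁻ x, maxTotal P (fun i => val i (x i)) ∂Measure.pi μ
      ≤ ∫⁻ x, maxTotal P (fun i => ψ i (x i)) ∂Measure.pi μ := by
  set lo : Fin n → X → ℝ≥0∞ := fun i => (H i)ᶜ.indicator (val i) with hlo
  set L : (Fin n → X) → ℝ≥0∞ := fun x => maxTotal P fun i => lo i (x i) with hL
  set one : ∀ i, (Fin n → X) → ℝ≥0∞ := fun i x => (H i).indicator 1 (x i) with hone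
  have hone_meas (i) : Measurable (one i) :=
    (measurable_one.indicator (hH i)).comp (measurable_pi_apply i)
  have hlo_meas (i) : Measurable (lo i) := (hval i).indicator (hH i).compl
  have hL_meas : Measurable L := (measurable_maxTotal P).comp
    (measurable_pi_lambda _ fun i => (hlo_meas i).comp (measurable_pi_apply i))
  -- the part of the optimum earned by low types, and by high types
  set A := ∫⁻ x, L x ∂Measure.pi μ with hA
  set B : Fin n → ℝ≥0∞ := fun i => ∫⁻ x, one i x * ψ i (x i) ∂Measure.pi μ with hB
  have hg_meas (i) : Measurable fun x : Fin n → X => one i x * ψ i (x i) :=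
    (hone_meas i).mul ((hψ i).comp (measurable_pi_apply i))
  have hA_top : A ≠ ∞ := by
    refine ne_top_of_le_ne_top ?_ (lintegral_mono fun x => maxTotal_le_sum P _)
    rw [lintegral_finsetSum _ fun i _ => by exact (hlo_meas i).comp (measurable_pi_apply i)]
    refine ENNReal.sum_ne_top.2 fun i _ => ?_
    rw [lintegral_pi_eval μ i (hlo_meas i)]
    exact ne_top_of_le_ne_top (hval_top i)
      (lintegral_mono (Set.indicator_le_self _ _))
  have hB_eq (i) : B i = ∫⁻ s in H i, ψ i s ∂μ i := by
    rw [← lintegral_indicator (hH i), ← lintegral_pi_eval μ i ((hψ i).indicator (hH i))]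
    refine lintegral_congr fun x => ?_
    by_cases hx : x i ∈ H i <;> simp [hone, hx]
  have hB_top (i) : B i ≠ ∞ := by
    rw [hB_eq]
    exact ne_top_of_le_ne_top (hψ_top i) (setLIntegral_le_lintegral _ _)
  set N : Set (Fin n → X) := {x | ∀ i, x i ∉ H i} with hN
  set N' : Fin n → Set (Fin n → X) := fun i => {x | ∀ j, j ≠ i → x j ∉ H j} with hN'
  have hmem (i) : MeasurableSet {x : Fin n → X | x i ∉ H i} :=
    (measurable_pi_apply (X := fun _ => X) i) (hH i).compl
  have hN_meas : MeasurableSet N := by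
    rw [hN, Set.ofPred_forall]
    exact MeasurableSet.iInter hmem
  have hN'_meas (i) : MeasurableSet (N' i) := by
    simp only [hN', Set.ofPred_forall]
    exact MeasurableSet.iInter fun j => MeasurableSet.iInter fun _ => hmem j
  have hA_le : A ≤ ∫⁻ x, N.indicator L x ∂Measure.pi μ + n * ε * A := by
    calc A ≤ ∫⁻ x, (N.indicator L x + ∑ i, one i x * L x) ∂Measure.pi μ := by
          refine lintegral_mono fun x => ?_
          by_cases hx : x ∈ N
          · simp [hx]
          · obtain ⟨i, hi⟩ : ∃ i, x i ∈ H i := by simpa [hN] using hx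
            refine le_trans ?_ (le_add_left (Finset.single_le_sum (fun _ _ => zero_le)
              (Finset.mem_univ i)))
            simp [hone, hi]
      _ ≤ _ := by
          rw [lintegral_add_left (hL_meas.indicator hN_meas),
            lintegral_finsetSum _ fun i _ => by exact (hone_meas i).mul hL_meas]
          gcongr
          calc _ ≤ ∑ _i : Fin n, ε * A := by
                refine Finset.sum_le_sum fun i _ => ?_
                refine (lintegral_indicator_eval_mul_le μ i (hH i) hL_meas fun x s hs => ?_).trans
                  (mul_le_mul_left (hHε i) _)
                refine maxTotal_mono P fun j => ?_
                by_cases hj : j = i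
                · subst hj; simp [hlo, hs]
                · rw [Function.update_of_ne hj]
            _ = _ := by simp [mul_assoc]
  have hB_le (i) : B i ≤ ∫⁻ x, (N' i).indicator (fun x => one i x * ψ i (x i)) x ∂Measure.pi μ
      + n * ε * B i := by
    calc B i ≤ ∫⁻ x, ((N' i).indicator (fun x => one i x * ψ i (x i)) x
            + ∑ j ∈ Finset.univ.erase i, one j x * (one i x * ψ i (x i))) ∂Measure.pi μ := by
          refine lintegral_mono fun x => ?_
          by_cases hx : x ∈ N' i
          · simp [hx]
          · obtain ⟨j, hji, hj⟩ : ∃ j, j ≠ i ∧ x j ∈ H j := by simpa [hN'] using hx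
            refine le_trans ?_ (le_add_left (Finset.single_le_sum (fun _ _ => zero_le)
              (Finset.mem_erase.2 ⟨hji, Finset.mem_univ j⟩)))
            simp [hone, hj]
      _ ≤ _ := by
          rw [lintegral_add_left ((hg_meas i).indicator (hN'_meas i)),
            lintegral_finsetSum _ fun j _ => by exact (hone_meas j).mul (hg_meas i)]
          gcongr
          calc _ ≤ ∑ _j ∈ Finset.univ.erase i, ε * B i := by
                refine Finset.sum_le_sum fun j hj => ?_
                refine (lintegral_indicator_eval_mul_le μ j (hH j) (hg_meas i)
                  fun x s _ => ?_).trans (mul_le_mul_left (hHε j) _)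
                have hij : i ≠ j := (Finset.ne_of_mem_erase hj).symm
                simp [hone, hij]
            _ ≤ ∑ _j : Fin n, ε * B i :=
                Finset.sum_le_sum_of_subset (Finset.subset_univ _)
            _ = _ := by simp [mul_assoc]
  set D : Finset (Fin n) := P.biUnion id with hD
  calc _ ≤ (1 - n * ε) * (A + ∑ i ∈ D, B i) := by
        gcongr
        calc _ ≤ ∫⁻ x, (L x + ∑ i ∈ D, (H i).indicator (val i) (x i)) ∂Measure.pi μ := by
              refine lintegral_mono fun x => Finset.sup_le fun S hS => ?_
              calc _ = ∑ i ∈ S, lo i (x i) + ∑ i ∈ S, (H i).indicator (val i) (x i) := by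
                    rw [← Finset.sum_add_distrib]
                    refine Finset.sum_congr rfl fun i _ => ?_
                    by_cases hx : x i ∈ H i <;> simp [hlo, hx]
                _ ≤ _ := add_le_add (sum_le_maxTotal hS _)
                    (Finset.sum_le_sum_of_subset (Finset.subset_biUnion_of_mem id hS))
          _ = A + ∑ i ∈ D, ∫⁻ s in H i, val i s ∂μ i := by
              rw [lintegral_add_left hL_meas, lintegral_finsetSum _ fun i _ =>
                by exact ((hval i).indicator (hH i)).comp (measurable_pi_apply i)]
              congr 1
              refine Finset.sum_congr rfl fun i _ => ?_
              rw [lintegral_pi_eval μ i ((hval i).indicator (hH i)), lintegral_indicator (hH i)]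
          _ ≤ _ := by
              gcongr with i
              rw [hB_eq]
              exact hhigh i
    _ ≤ ∫⁻ x, N.indicator L x ∂Measure.pi μ + ∑ i ∈ D,
          ∫⁻ x, (N' i).indicator (fun x => one i x * ψ i (x i)) x ∂Measure.pi μ := by
        rw [mul_add, Finset.mul_sum]
        exact add_le_add (one_sub_mul_le_of_le_add hA_top hA_le)
          (Finset.sum_le_sum fun i _ => one_sub_mul_le_of_le_add (hB_top i) (hB_le i))
    _ ≤ _ := by
        rw [← lintegral_finsetSum _ fun i _ => (hg_meas i).indicator (hN'_meas i),
          ← lintegral_add_left (hL_meas.indicator hN_meas)]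
        refine lintegral_mono fun x => ?_
        by_cases hx : x ∈ N
        · have h0 (i) : (N' i).indicator (fun x => one i x * ψ i (x i)) x = 0 := by
            have : x i ∉ H i := hx i
            simp [hone, this]
          simp only [h0, Finset.sum_const_zero, add_zero, Set.indicator_of_mem hx]
          refine maxTotal_mono P fun i => ?_
          have : x i ∉ H i := hx i
          simpa [hlo, this] using hlow i _ this
        · rw [Set.indicator_of_notMem hx, zero_add]
          obtain ⟨i, hi⟩ : ∃ i, x i ∈ H i := by simpa [hN] using hx
          have h0 (j) (hj : j ≠ i) : (N' j).indicator (fun x => one j x * ψ j (x j)) x = 0 :=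
            Set.indicator_of_notMem (fun h : x ∈ N' j => h i hj.symm hi) _
          by_cases hiD : i ∈ D
          · rw [Finset.sum_eq_single_of_mem i hiD fun j _ hj => h0 j hj]
            obtain ⟨S, hS, hiS⟩ := Finset.mem_biUnion.1 hiD
            calc _ ≤ one i x * ψ i (x i) :=
                Set.indicator_le_self (N' i) (fun x => one i x * ψ i (x i)) x
              _ = ψ i (x i) := by simp [hone, hi]
              _ ≤ ∑ j ∈ S, ψ j (x j) :=
                Finset.single_le_sum (f := fun j => ψ j (x j)) (fun _ _ => zero_le) hiS
              _ ≤ _ := sum_le_maxTotal hS _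
          · rw [Finset.sum_eq_zero fun j hj => h0 j fun h => hiD (h ▸ hj)]
            exact zero_le

end Truncation

/-! ### Comparing the optimal surplus with the optimal consumer surplus -/

section TruncatedTopMean

variable (F : Measure ℝ≥0) [IsProbabilityMeasure F]

/-- The score of a type: the average value over the quantiles above its own, quantiles below `ε`
being pooled. -/
noncomputable def score (ε : ℝ) (x : ℝ≥0 × unitInterval) : ℝ≥0∞ :=
  topMean F (max (quantile F x) ε)

lemma score_anti {ε : ℝ} (hε : 0 < ε) {x x' : ℝ≥0 × unitInterval}
    (h : quantile F x ≤ quantile F x') : score F ε x' ≤ score F ε x :=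
  topMean_anti F (hε.trans_le (le_max_right _ _)) (max_le_max_right _ h)

lemma measurable_score {ε : ℝ} (hε : 0 < ε) : Measurable (score F ε) := by
  have h : Antitone fun s : ℝ => topMean F (max s ε) := fun s t hst =>
    topMean_anti F (hε.trans_le (le_max_right _ _)) (max_le_max_right _ hst)
  exact h.measurable.comp (measurable_quantile F)

lemma score_ne_top (hF : ∫⁻ w, (w : ℝ≥0∞) ∂F ≠ ∞) (ε : ℝ) (x : ℝ≥0 × unitInterval) :
    score F ε x ≠ ∞ := topMean_ne_top F hF _

lemma lintegral_score_ne_top (hF : ∫⁻ w, (w : ℝ≥0∞) ∂F ≠ ∞) {ε : ℝ} (hε : 0 < ε) :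
    ∫⁻ x, score F ε x ∂(F.prod volume) ≠ ∞ := by
  refine ne_top_of_le_ne_top (topMean_ne_top F hF ε)
    ((lintegral_mono fun x => topMean_anti F hε (le_max_right (quantile F x) ε)).trans_eq ?_)
  simp

/-- The expected score of the agents selected with probabilities `y` is at most the mixture, with
weights `1` and `dτ / τ`, of the utilities they enjoy under the threshold mechanisms. -/
lemma lintegral_score_mul_le {ε : ℝ} (hε : 0 < ε) (hε1 : ε ≤ 1)
    {y : ℝ≥0 × unitInterval → ℝ≥0∞} (hy : Measurable y) :
    ∫⁻ x, score F ε x * y x ∂(F.prod volume)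
      ≤ (∫⁻ x, y x ∂(F.prod volume)) * ∫⁻ w, (w : ℝ≥0∞) ∂F
        + ∫⁻ τ in Set.Ioo ε 1, ENNReal.ofReal τ⁻¹
          * ((∫⁻ x in {x | quantile F x ≤ τ}, y x ∂(F.prod volume)) / ENNReal.ofReal τ
            * excess F τ) := by
  set w : ℝ → ℝ≥0∞ := fun τ => ENNReal.ofReal (τ ^ 2)⁻¹ * excess F τ with hw
  have hw_meas : Measurable w :=
    (measurable_id.pow_const 2).inv.ennreal_ofReal.mul (measurable_excess F)
  have hset : MeasurableSet {p : (ℝ≥0 × unitInterval) × ℝ | quantile F p.1 ≤ p.2} :=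
    measurableSet_le ((measurable_quantile F).comp measurable_fst) measurable_snd
  have hmeas : Measurable fun p : (ℝ≥0 × unitInterval) × ℝ =>
      {p : (ℝ≥0 × unitInterval) × ℝ | quantile F p.1 ≤ p.2}.indicator
        (fun p => y p.1 * w p.2) p :=
    ((hy.comp measurable_fst).mul (hw_meas.comp measurable_snd)).indicator hset
  calc _ ≤ ∫⁻ x, (y x * ∫⁻ w, (w : ℝ≥0∞) ∂F + ∫⁻ τ in Set.Ioo ε 1,
          {p : (ℝ≥0 × unitInterval) × ℝ | quantile F p.1 ≤ p.2}.indicator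
            (fun p => y p.1 * w p.2) (x, τ)) ∂(F.prod volume) := by
        refine lintegral_mono fun x => ?_
        have h1 := topMean_le F (hε.trans_le (le_max_right (quantile F x) ε))
          (max_le (quantile_le_one F x) hε1)
        rw [mul_comm]
        refine (mul_le_mul_right h1 _).trans ?_
        rw [mul_add]
        gcongr
        rw [← lintegral_const_mul _ hw_meas]
        calc _ = ∫⁻ τ in Set.Ioo (max (quantile F x) ε) 1,
              {p : (ℝ≥0 × unitInterval) × ℝ | quantile F p.1 ≤ p.2}.indicator
                (fun p => y p.1 * w p.2) (x, τ) := by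
              refine setLIntegral_congr_fun measurableSet_Ioo fun τ hτ => ?_
              have : quantile F x ≤ τ := (le_max_left _ _).trans hτ.1.le
              simp [this]
          _ ≤ _ := lintegral_mono_set (Set.Ioo_subset_Ioo_left (le_max_right _ _))
    _ = _ := by
        rw [lintegral_add_left (hy.mul_const _), lintegral_mul_const _ hy,
          lintegral_lintegral_swap hmeas.aemeasurable]
        congr 1
        refine setLIntegral_congr_fun measurableSet_Ioo fun τ hτ => ?_
        have hτ0 : 0 < τ := hε.trans hτ.1
        have h2 : (fun x : ℝ≥0 × unitInterval =>
            {p : (ℝ≥0 × unitInterval) × ℝ | quantile F p.1 ≤ p.2}.indicator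
              (fun p => y p.1 * w p.2) (x, τ))
            = {x | quantile F x ≤ τ}.indicator fun x => y x * w τ := by
          ext x; simp [Set.indicator_apply]
        rw [h2, lintegral_indicator (measurableSet_quantile_le F τ), lintegral_mul_const _ hy]
        have h3 : ENNReal.ofReal (τ ^ 2)⁻¹ = ENNReal.ofReal τ⁻¹ * (ENNReal.ofReal τ)⁻¹ := by
          rw [← ENNReal.ofReal_inv_of_pos hτ0, ← ENNReal.ofReal_mul (inv_nonneg.2 hτ0.le)]
          congr 1
          ring
        simp only [hw, h3, div_eq_mul_inv]
        ring

end TruncatedTopMean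

namespace Env

variable {n : ℕ} (E : Env n)

/-- Selection of a feasible set by the scores with pooling below `ε`. -/
noncomputable def scoreRule {ε : ℝ} (hε : 0 < ε) : E.SelectionRule (ℝ≥0 × unitInterval) :=
  E.maxRule (fun i x => (score (E.dist i) ε x).toReal)
    fun i => (measurable_score (E.dist i) hε).ennreal_toReal

lemma maxTotal_score_le {ε : ℝ} (hε : 0 < ε) (x : Fin n → ℝ≥0 × unitInterval) :
    maxTotal E.feasible (fun i => score (E.dist i) ε (x i))
      ≤ ∑ i ∈ (E.scoreRule hε).select x, score (E.dist i) ε (x i) := by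
  refine Finset.sup_le fun S hS => ?_
  have htop (i) : score (E.dist i) ε (x i) ≠ ∞ := score_ne_top _ (E.finiteMean i).ne ε _
  rw [← ENNReal.toReal_le_toReal (ENNReal.sum_ne_top.2 fun i _ => htop i)
    (ENNReal.sum_ne_top.2 fun i _ => htop i), ENNReal.toReal_sum fun i _ => htop i,
    ENNReal.toReal_sum fun i _ => htop i]
  exact E.sum_le_sum_maxRule
    (fun i => (measurable_score (E.dist i) hε).ennreal_toReal) x hS

lemma selectProb_scoreRule_anti {ε : ℝ} (hε : 0 < ε) (i : Fin n) (x x' : ℝ≥0 × unitInterval)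
    (h : quantile (E.dist i) x ≤ quantile (E.dist i) x') :
    (E.scoreRule hε).selectProb E.typeLaw i x' ≤ (E.scoreRule hε).selectProb E.typeLaw i x := by
  refine measure_mono fun z hz => ?_
  have := E.mem_maxRule_update
    (fun i => (measurable_score (E.dist i) hε).ennreal_toReal) (s := x) ?_ hz
  · rwa [Function.update_idem] at this
  · rw [Function.update_self]
    exact ENNReal.toReal_mono (score_ne_top _ (E.finiteMean i).ne ε _)
      (score_anti (E.dist i) hε h)

/-- Averaging the utilities of the threshold mechanisms over `τ`, of total weight `1 - ln ε`. -/
theorem lintegral_maxTotal_score_le {ε : ℝ} (hε : 0 < ε) (hε1 : ε ≤ 1) :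
    ∫⁻ x, maxTotal E.feasible (fun i => score (E.dist i) ε (x i)) ∂Measure.pi E.typeLaw
      ≤ ENNReal.ofReal (1 - Real.log ε) * E.optConsumerSurplus := by
  set a := E.scoreRule hε with ha
  have hlog : Real.log ε ≤ 0 := Real.log_nonpos hε.le hε1
  have hterm (i : Fin n) : Measurable fun x : Fin n → ℝ≥0 × unitInterval =>
      score (E.dist i) ε (x i) := (measurable_score (E.dist i) hε).comp (measurable_pi_apply i)
  have hmono (i : Fin n) : Monotone fun τ : ℝ =>
      ∫⁻ x in {x | quantile (E.dist i) x ≤ τ}, a.selectProb E.typeLaw i x ∂E.typeLaw i :=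
    fun τ τ' h => lintegral_mono_set fun x hx => le_trans hx h
  have hτmeas (i : Fin n) : Measurable fun τ : ℝ => ENNReal.ofReal τ⁻¹
      * ((∫⁻ x in {x | quantile (E.dist i) x ≤ τ}, a.selectProb E.typeLaw i x ∂E.typeLaw i)
        / ENNReal.ofReal τ * excess (E.dist i) τ) :=
    measurable_inv.ennreal_ofReal.mul
      (((hmono i).measurable.div ENNReal.measurable_ofReal).mul (measurable_excess _))
  calc _ ≤ ∫⁻ x, ∑ i, {x | i ∈ a.select x}.indicator (fun x => score (E.dist i) ε (x i)) x
          ∂Measure.pi E.typeLaw := by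
        refine lintegral_mono fun x => (E.maxTotal_score_le hε x).trans_eq ?_
        simp [Set.indicator_apply, Finset.sum_ite_mem, ha]
    _ = ∑ i, ∫⁻ s, score (E.dist i) ε s * a.selectProb E.typeLaw i s ∂E.typeLaw i := by
        rw [lintegral_finsetSum _ fun i _ => (hterm i).indicator (a.measurableSet_mem i)]
        refine Finset.sum_congr rfl fun i _ => ?_
        rw [lintegral_indicator (a.measurableSet_mem i),
          a.lintegral_select_eq i (measurable_score (E.dist i) hε)]
    _ ≤ ∑ i, ((∫⁻ x, a.selectProb E.typeLaw i x ∂E.typeLaw i) * ∫⁻ w, (w : ℝ≥0∞) ∂E.dist i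
        + ∫⁻ τ in Set.Ioo ε 1, ENNReal.ofReal τ⁻¹
          * ((∫⁻ x in {x | quantile (E.dist i) x ≤ τ}, a.selectProb E.typeLaw i x ∂E.typeLaw i)
            / ENNReal.ofReal τ * excess (E.dist i) τ)) :=
        Finset.sum_le_sum fun i _ =>
          lintegral_score_mul_le (E.dist i) hε hε1 (a.measurable_selectProb i)
    _ ≤ E.optConsumerSurplus + ∫⁻ τ in Set.Ioo ε 1, ENNReal.ofReal τ⁻¹ * E.optConsumerSurplus := by
        rw [Finset.sum_add_distrib, ← lintegral_finsetSum _ fun i _ => hτmeas i]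
        refine add_le_add (sum_selectProb_mul_mean_le a)
          (setLIntegral_mono' measurableSet_Ioo fun τ hτ => ?_)
        rw [← Finset.mul_sum]
        exact mul_le_mul_right (sum_selectProb_mul_excess_le a (hε.trans hτ.1) hτ.2
          (E.selectProb_scoreRule_anti hε)) _
    _ = _ := by
        rw [lintegral_mul_const _ measurable_inv.ennreal_ofReal, setLIntegral_Ioo_inv hε hε1,
          sub_eq_add_neg, ENNReal.ofReal_add zero_le_one (neg_nonneg.2 hlog), add_mul,
          ENNReal.ofReal_one, one_mul]

lemma optSurplus_eq : E.optSurplus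
    = ∫⁻ x, maxTotal E.feasible (fun i => ((x i).1 : ℝ≥0∞)) ∂Measure.pi E.typeLaw := by
  have h : MeasurePreserving (fun (x : Fin n → ℝ≥0 × unitInterval) i => (x i).1)
      (Measure.pi E.typeLaw) (Measure.pi E.dist) :=
    measurePreserving_pi E.typeLaw E.dist fun i => measurePreserving_fst
  have hm : Measurable fun v : Fin n → ℝ≥0 => maxTotal E.feasible fun i => (v i : ℝ≥0∞) :=
    (measurable_maxTotal E.feasible).comp
      (measurable_pi_lambda _ fun i => (measurable_pi_apply i).coe_nnreal_ennreal)
  exact (h.lintegral_comp hm).symm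

theorem one_sub_mul_optSurplus_le {ε : ℝ} (hε : 0 < ε) (hε1 : ε ≤ 1) :
    (1 - n * ENNReal.ofReal ε) * E.optSurplus
      ≤ ENNReal.ofReal (1 - Real.log ε) * E.optConsumerSurplus := by
  rw [optSurplus_eq]
  refine (one_sub_mul_lintegral_maxTotal_le E.typeLaw E.feasible
    (H := fun i => {x | quantile (E.dist i) x ≤ ε}) (val := fun i x => (x.1 : ℝ≥0∞))
    (ψ := fun i => score (E.dist i) ε)
    (fun i => measurableSet_quantile_le _ _) (fun i => (measure_quantile_le _ hε hε1).le)
    (fun i => measurable_fst.coe_nnreal_ennreal) (fun i => measurable_score _ hε) (fun i => ?_)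
    (fun i => lintegral_score_ne_top _ (E.finiteMean i).ne hε) (fun i x hx => ?_)
    (fun i => ?_)).trans (E.lintegral_maxTotal_score_le hε hε1)
  · have h : MeasurePreserving Prod.fst (E.typeLaw i) (E.dist i) := measurePreserving_fst
    exact (h.lintegral_comp measurable_coe_nnreal_ennreal).trans_ne (E.finiteMean i).ne
  · have hx' : ε < quantile (E.dist i) x := not_le.1 hx
    rw [score, max_eq_left hx'.le]
    exact le_topMean_quantile _ (hε.trans hx')
  · refine (setLIntegral_quantile_le_le (E.dist i) hε hε1).trans_eq ?_
    have : ∫⁻ x in {x | quantile (E.dist i) x ≤ ε}, score (E.dist i) ε x ∂E.typeLaw i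
        = ∫⁻ x in {x | quantile (E.dist i) x ≤ ε}, topMean (E.dist i) ε ∂E.typeLaw i :=
      setLIntegral_congr_fun (measurableSet_quantile_le _ _) fun x hx => by
        have hx' : quantile (E.dist i) x ≤ ε := hx
        simp only [score, max_eq_right hx']
    rw [this, setLIntegral_const, measure_quantile_le _ hε hε1, mul_comm]

end Env

/-! ### The bound and its asymptotics -/

lemma zeta_le_omniscientBound {n : ℕ} {ε : ℝ} (hn : 1 ≤ n) (hε : 0 < ε) (h : 2 * (n : ℝ) * ε < 1) :
    zeta n ≤ ENNReal.ofReal (omniscientBound n ε) := by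
  have hn' : (1 : ℝ) ≤ n := by exact_mod_cast hn
  have hnε : ε ≤ n * ε := le_mul_of_one_le_left hε.le hn'
  have hε1 : ε ≤ 1 := by nlinarith
  have hnum : 0 ≤ 1 - Real.log ε := by linarith [Real.log_nonpos hε.le hε1]
  have hpos : 0 < 1 - n * ε := by nlinarith
  -- the first two factors of the denominator multiply to `1 - 2 ε`
  have hden : (1 - ε / (1 - ε)) * (1 - ε) * (1 - 2 * (n : ℝ) * ε)
      = (1 - 2 * ε) * (1 - 2 * (n : ℝ) * ε) := by
    have : 1 - ε ≠ 0 := by nlinarith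
    field_simp
    ring
  have hB : (1 - Real.log ε) / (1 - n * ε) ≤ omniscientBound n ε := by
    rw [omniscientBound, hden]
    refine div_le_div_of_nonneg_left hnum (mul_pos (by nlinarith) (by linarith)) ?_
    nlinarith
  refine iSup_le fun E => ENNReal.div_le_of_le_mul ?_
  have hmain := E.one_sub_mul_optSurplus_le hε hε1
  rw [show (1 : ℝ≥0∞) - n * ENNReal.ofReal ε = ENNReal.ofReal (1 - n * ε) by
    rw [ENNReal.ofReal_sub _ (by positivity), ENNReal.ofReal_mul (by positivity)]; simp] at hmain
  refine le_trans ?_ (mul_le_mul_left (ENNReal.ofReal_le_ofReal hB) _)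
  rw [ENNReal.ofReal_div_of_pos hpos, ENNReal.mul_comm_div, ← mul_div_assoc]
  rw [ENNReal.le_div_iff_mul_le (.inl (by simpa using hpos)) (.inl ENNReal.ofReal_ne_top),
    mul_comm]
  exact hmain

lemma tendsto_omniscientBound_div_log :
    Filter.Tendsto (fun n : ℕ => omniscientBound n (1 / ((n : ℝ) * Real.log n)) / Real.log n)
      Filter.atTop (𝓝 1) := by
  have hn : Filter.Tendsto (fun n : ℕ => (n : ℝ)) Filter.atTop Filter.atTop :=
    tendsto_natCast_atTop_atTop
  have hlog : Filter.Tendsto (fun n : ℕ => Real.log n) Filter.atTop Filter.atTop :=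
    Real.tendsto_log_atTop.comp hn
  have hinv : Filter.Tendsto (fun n : ℕ => (Real.log n)⁻¹) Filter.atTop (𝓝 0) :=
    tendsto_inv_atTop_zero.comp hlog
  have hninv : Filter.Tendsto (fun n : ℕ => (n : ℝ)⁻¹) Filter.atTop (𝓝 0) :=
    tendsto_inv_atTop_zero.comp hn
  have hloglog : Filter.Tendsto (fun n : ℕ => Real.log (Real.log n) / Real.log n)
      Filter.atTop (𝓝 0) :=
    (Real.isLittleO_log_id_atTop.tendsto_div_nhds_zero).comp hlog
  have hlim : Filter.Tendsto (fun n : ℕ =>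
      (1 + ((Real.log n)⁻¹ + Real.log (Real.log n) / Real.log n))
        / ((1 - 2 * ((n : ℝ)⁻¹ * (Real.log n)⁻¹)) * (1 - 2 * (Real.log n)⁻¹)))
      Filter.atTop (𝓝 ((1 + (0 + 0)) / ((1 - 2 * (0 * 0)) * (1 - 2 * 0)))) :=
    ((hinv.add hloglog).const_add 1).div
      ((((hninv.mul hinv).const_mul 2).const_sub 1).mul ((hinv.const_mul 2).const_sub 1))
      (by norm_num)
  have h1 : (1 + (0 + 0)) / ((1 - 2 * (0 * 0)) * (1 - 2 * 0)) = (1 : ℝ) := by norm_num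
  rw [h1] at hlim
  refine hlim.congr' ?_
  filter_upwards [hlog.eventually_gt_atTop 2, hn.eventually_gt_atTop 2] with n hl hn2
  have hl0 : Real.log n ≠ 0 := by linarith
  have hn0 : (n : ℝ) ≠ 0 := by linarith
  have hprod : 1 < (n : ℝ) * Real.log n := by nlinarith
  have hε : 1 - 1 / ((n : ℝ) * Real.log n) ≠ 0 := by
    have := (div_lt_one (by linarith)).2 hprod
    linarith
  rw [omniscientBound, one_div, Real.log_inv, Real.log_mul hn0 hl0]
  rw [one_div] at hε
  have e1 : (1 - ((n : ℝ) * Real.log n)⁻¹ / (1 - ((n : ℝ) * Real.log n)⁻¹))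
      * (1 - ((n : ℝ) * Real.log n)⁻¹) = 1 - 2 * ((n : ℝ)⁻¹ * (Real.log n)⁻¹) := by
    rw [sub_mul, div_mul_cancel₀ _ hε, mul_inv]
    ring
  have e2 : 1 - 2 * (n : ℝ) * ((n : ℝ) * Real.log n)⁻¹ = 1 - 2 * (Real.log n)⁻¹ := by
    field_simp
  rw [e1, e2, div_right_comm]
  congr 1
  field_simp
  ring

theorem mainTheorem3 :
    (∀ (n : ℕ) (ε : ℝ), 1 ≤ n → 0 < ε → 2 * (n : ℝ) * ε < 1 →
      zeta n ≤ ENNReal.ofReal (omniscientBound n ε)) ∧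
    Filter.Tendsto
      (fun n : ℕ => omniscientBound n (1 / ((n : ℝ) * Real.log n)) / Real.log n)
      Filter.atTop (𝓝 1) ∧
    (∃ δ : ℕ → ℝ, Filter.Tendsto δ Filter.atTop (𝓝 0) ∧
      ∀ n : ℕ, 2 ≤ n → zeta n ≤ ENNReal.ofReal ((1 + δ n) * Real.log n)) := by
  refine ⟨fun n ε => zeta_le_omniscientBound, tendsto_omniscientBound_div_log, ?_⟩
  -- for small `n` the choice `1 / (n ln n)` is not below `1 / (2 n)`, and any other will do
  set e : ℕ → ℝ := fun n =>
    if 2 < Real.log n then 1 / ((n : ℝ) * Real.log n) else 1 / (4 * n) with he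
  refine ⟨fun n => omniscientBound n (e n) / Real.log n - 1, ?_, fun n hn => ?_⟩
  · have h := tendsto_omniscientBound_div_log.sub_const 1
    rw [sub_self] at h
    refine h.congr' ?_
    have hlog : Filter.Tendsto (fun n : ℕ => Real.log n) Filter.atTop Filter.atTop :=
      Real.tendsto_log_atTop.comp tendsto_natCast_atTop_atTop
    filter_upwards [hlog.eventually_gt_atTop 2] with n hl
    simp [he, hl]
  · have hn2 : (2 : ℝ) ≤ n := by exact_mod_cast hn
    have hlog : 0 < Real.log n := Real.log_pos (by linarith)
    have hn0 : (0 : ℝ) < n := by linarith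
    rw [add_sub_cancel, div_mul_cancel₀ _ hlog.ne']
    refine zeta_le_omniscientBound (by omega) ?_ ?_
    · simp only [he]
      split_ifs <;> positivity
    · simp only [he]
      split_ifs with hl
      · rw [show 2 * (n : ℝ) * (1 / (n * Real.log n)) = 2 / Real.log n by field_simp]
        exact (div_lt_one hlog).2 hl
      · rw [show 2 * (n : ℝ) * (1 / (4 * n)) = 1 / 2 by field_simp; norm_num]
        norm_num
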